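/- Let $\mathcal H_A\simeq\mathcal H_B\simeq\mathbb C^d$ with fixed orthonormal bases, let $n\ge 1$, and identify $(\mathcal H_A\otimes\mathcal H_B)^{\otimes n}$ with $\mathcal H_A^{\otimes n}\otimes\mathcal H_B^{\otimes n}$. Let $\Gamma=|\Gamma\rangle\langle\Gamma|$ with $|\Gamma\rangle=\sum_i|i\rangle_A\otimes|i\rangle_B$, let $P_\pi$ be the unitary permuting the tensor factors of an $n$-fold tensor power according to $\pi\in S_n$, and let $\mathbb E_U$ be the expectation over a Haar-random unitary $U$ on $\mathcal H_B$. Put $$R_n=\mathbb E_U\big[(\mathbb 1_{A^n}\otimes U^{\otimes n})\,\Gamma^{\otimes n}\,(\mathbb 1_{A^n}\otimes (U^\dagger)^{\otimes n})\big],\qquad \Lambda^{(n)}(X)=\sqrt{R_n}\,(X\otimes\mathbb 1_{B^n})\,\sqrt{R_n}.$$ Then: 1. $R_n$ is positive semidefinite, and $\Lambda^{(n)}$ is completely positive and trace preserving, i.e. a quantum channel. 2. $\Lambda^{(n)}$ equals the random purification channel of Tang, Wright and Zhandry, on all operators on $\mathcal H_A^{\otimes n}$. Explicitly, a Schur transform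 is a unitary from $(\mathbb C^d)^{\otimes n}$ onto $\bigoplus_\lambda Q_\lambda\otimes P_\lambda$ that turns $P_\pi$ into $\bigoplus_\lambda \mathbb 1\otimes p_\lambda(\pi)$ and $U^{\otimes n}$ into $\bigoplus_\lambda q_\lambda(U)\otimes\mathbb 1$, where the $p_\lambda$ are pairwise inequivalent irreducible representations of $S_n$ by matrices and the $q_\lambda$ pairwise inequivalent irreducible representations of $U(d)$ by matrices. Take Schur transforms of $\mathcal H_A^{\otimes n}$ and $\mathcal H_B^{\otimes n}$ with the same labels and dimensions, such that the matrices $p_\lambda(\pi)$ for $B$ are the entrywise complex conjugates of those for $A$ (for instance twice the same one, if these matrices are real). Such a pair exists. For every such pair, $\Lambda^{(n)}$ is the following map: apply the Schur transform to $A^n$, measure $\lambda$, discard the register $P_\lambda$, prepare the maximally mixed state on a second copy of $Q_\lambda$ and the normalised maximally entangled state on two fresh copies of $P_\lambda$, and apply the inverse Schur transforms to obtain a state on $A^nB^n$. 3. For every state $\rho$ on $\mathcal H_A$ and every purification $\psi_\rho$ of $\rho$ in $\mathcal H_A\otimes\mathcal H_B$, $$\Lambda^{(n)}(\rho^{\otimes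 n})=\mathbb E_U\Big[\big((\mathbb 1_A\otimes U)\,\psi_\rho\,(\mathbb 1_A\otimes U^\dagger)\big)^{\otimes n}\Big].$$ Moreover $\Lambda^{(n)}(P_\pi XP_\pi^\dagger)=\Lambda^{(n)}(X)$ for all $\pi\in S_n$ and all $X$, and $\Lambda^{(n)}$ is the only linear map with these two properties. 4. More generally, let $\rho_{A^n}$ be a permutationally symmetric state on $\mathcal H_A^{\otimes n}$, i.e. $P_\pi\rho_{A^n}P_\pi^\dagger=\rho_{A^n}$ for all $\pi$. Call a purification $|\psi\rangle\in\mathcal H_A^{\otimes n}\otimes\mathcal H_B^{\otimes n}$ of $\rho_{A^n}$ permutationally symmetric if it lies in the symmetric subspace of $(\mathcal H_A\otimes\mathcal H_B)^{\otimes n}$, i.e. $(P_\pi\otimes P_\pi)|\psi\rangle=|\psi\rangle$ for all $\pi\in S_n$. Such purifications of $\rho_{A^n}$ exist; for any such $|\psi\rangle$ and every unitary $U$, $(\mathbb 1\otimes U^{\otimes n})|\psi\rangle$ is again a permutationally symmetric purification of $\rho_{A^n}$; and $$\Lambda^{(n)}(\rho_{A^n})=\mathbb E_U\big[(\mathbb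 1_{A^n}\otimes U^{\otimes n})\,|\psi\rangle\langle\psi|\,(\mathbb 1_{A^n}\otimes U^{\otimes n})^\dagger\big].$$ -/

import Mathlib

open scoped Matrix Kronecker ComplexOrder MatrixOrder

namespace RandomPurification

/-! `H_A = H_B = ℂ^d`, with the standard basis indexed by a finite type `d`. Operators are matrices;
the `n`-fold tensor power of `ℂ^m` has the product basis indexed by `Fin n → m`. -/

section Basic

variable {a b m : Type*} [Fintype a] [Fintype b]

/-- `M^{⊗n}` -/
def tensorPow (n : ℕ) (M : Matrix m m ℂ) : Matrix (Fin n → m) (Fin n → m) ℂ :=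
  Matrix.of fun i j => ∏ k, M (i k) (j k)

/-- The canonical identification of operators on `(A ⊗ B)^{⊗n}` with operators on
`A^{⊗n} ⊗ B^{⊗n}`. -/
def regroup {n : ℕ} (X : Matrix (Fin n → a × b) (Fin n → a × b) ℂ) :
    Matrix ((Fin n → a) × (Fin n → b)) ((Fin n → a) × (Fin n → b)) ℂ :=
  X.submatrix (fun x k => (x.1 k, x.2 k)) (fun x k => (x.1 k, x.2 k))

/-- The unitary `P_π |x_1, …, x_n⟩ = |x_{π⁻¹(1)}, …, x_{π⁻¹(n)}⟩` on `(ℂ^m)^{⊗n}`. -/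
def permMatrix [DecidableEq m] {n : ℕ} (π : Equiv.Perm (Fin n)) :
    Matrix (Fin n → m) (Fin n → m) ℂ :=
  Matrix.of fun i j => if i = j ∘ ⇑π⁻¹ then 1 else 0

/-- `P_π X P_π† = X` for all `π`. -/
def IsPermSymmetric [DecidableEq m] [Fintype m] {n : ℕ}
    (X : Matrix (Fin n → m) (Fin n → m) ℂ) : Prop :=
  ∀ π : Equiv.Perm (Fin n), permMatrix π * X * (permMatrix π)ᴴ = X

/-- Density operators. -/
def IsState (ρ : Matrix a a ℂ) : Prop := ρ.PosSemidef ∧ ρ.trace = 1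

/-- `|ψ⟩⟨ψ|` -/
def ketbra (ψ : a → ℂ) : Matrix a a ℂ := Matrix.vecMulVec ψ (star ψ)

/-- The partial trace over the second tensor factor. -/
def traceSnd (X : Matrix (a × b) (a × b) ℂ) : Matrix a a ℂ :=
  Matrix.of fun i j => ∑ k, X (i, k) (j, k)

/-- The vector `ψ ∈ A ⊗ B` is a purification of `ρ`, an operator on `A`. -/
def IsPurification (ψ : a × b → ℂ) (ρ : Matrix a a ℂ) : Prop := traceSnd (ketbra ψ) = ρ

/-- Complete positivity: `Φ ⊗ id_k` preserves positive semidefiniteness for every `k`. -/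
def IsCompletelyPositive (Φ : Matrix a a ℂ →ₗ[ℂ] Matrix b b ℂ) : Prop :=
  ∀ (k : ℕ) (X : Matrix (a × Fin k) (a × Fin k) ℂ), X.PosSemidef →
    (Matrix.of fun x y : b × Fin k =>
      Φ (Matrix.of fun i j => X (i, x.2) (j, y.2)) x.1 y.1).PosSemidef

/-- Quantum channels: completely positive trace-preserving linear maps. -/
def IsChannel (Φ : Matrix a a ℂ →ₗ[ℂ] Matrix b b ℂ) : Prop :=
  IsCompletelyPositive Φ ∧ ∀ X, (Φ X).trace = X.trace

end Basic

section Haar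

variable {d : Type*} [Fintype d] [DecidableEq d]

instance : CompactSpace (Matrix.unitaryGroup d ℂ) := by
  refine isCompact_iff_compactSpace.mp ?_
  have h1 : IsCompact (Set.pi Set.univ fun _ : d => Set.pi Set.univ fun _ : d =>
      Metric.closedBall (0 : ℂ) 1) :=
    isCompact_univ_pi fun _ => isCompact_univ_pi fun _ => isCompact_closedBall 0 1
  refine IsCompact.of_isClosed_subset (X := Matrix d d ℂ) h1 isClosed_unitary ?_
  intro U hU i _ j _
  simpa using entry_norm_bound_of_unitary hU i j

noncomputable instance : MeasurableSpace (Matrix.unitaryGroup d ℂ) := borel _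

instance : BorelSpace (Matrix.unitaryGroup d ℂ) := ⟨rfl⟩

variable (d) in
/-- The Haar probability measure on the unitary group `U(d)`. -/
noncomputable def haarU : MeasureTheory.Measure (Matrix.unitaryGroup d ℂ) :=
  MeasureTheory.Measure.haarMeasure ⊤

/-- The (entrywise) expectation of a matrix-valued function of a Haar-random unitary. -/
noncomputable def haarMean {a : Type*} (F : Matrix.unitaryGroup d ℂ → Matrix a a ℂ) :
    Matrix a a ℂ :=
  Matrix.of fun i j => ∫ U, F U i j ∂(haarU d)

end Haar

section Channel

variable (d : Type*) [Fintype d] [DecidableEq d]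

/-- `|Γ⟩ = ∑ i, |i⟩ ⊗ |i⟩` -/
def gammaVec : d × d → ℂ := fun x => if x.1 = x.2 then 1 else 0

/-- `R_n = E_U [(1 ⊗ U^{⊗n}) Γ^{⊗n} (1 ⊗ (U†)^{⊗n})]` on `A^{⊗n} ⊗ B^{⊗n}` -/
noncomputable def R (n : ℕ) : Matrix ((Fin n → d) × (Fin n → d)) ((Fin n → d) × (Fin n → d)) ℂ :=
  haarMean fun U : Matrix.unitaryGroup d ℂ =>
    ((1 : Matrix (Fin n → d) (Fin n → d) ℂ) ⊗ₖ tensorPow n (U : Matrix d d ℂ)) *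
      regroup (tensorPow n (ketbra (gammaVec d))) *
      ((1 : Matrix (Fin n → d) (Fin n → d) ℂ) ⊗ₖ tensorPow n (U : Matrix d d ℂ)ᴴ)

/-- `Λ^{(n)}(X) = √R_n (X ⊗ 1) √R_n` -/
noncomputable def purify (n : ℕ) : Matrix (Fin n → d) (Fin n → d) ℂ →ₗ[ℂ]
    Matrix ((Fin n → d) × (Fin n → d)) ((Fin n → d) × (Fin n → d)) ℂ where
  toFun X := CFC.sqrt (R d n) * (X ⊗ₖ (1 : Matrix (Fin n → d) (Fin n → d) ℂ)) * CFC.sqrt (R d n)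
  map_add' X Y := by rw [Matrix.add_kronecker, mul_add, add_mul]
  map_smul' c X := by
    rw [Matrix.smul_kronecker, mul_smul_comm, smul_mul_assoc, RingHom.id_apply]

variable {d}

/-- `Φ(ρ^{⊗n}) = E_U [((1 ⊗ U) ψ_ρ (1 ⊗ U†))^{⊗n}]` for every state `ρ` on `A` and every
purification `ψ_ρ` of `ρ` in `A ⊗ B`. -/
def PurifiesIID (n : ℕ) (Φ : Matrix (Fin n → d) (Fin n → d) ℂ →ₗ[ℂ]
    Matrix ((Fin n → d) × (Fin n → d)) ((Fin n → d) × (Fin n → d)) ℂ) : Prop :=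
  ∀ (ρ : Matrix d d ℂ) (ψ : d × d → ℂ), IsState ρ → IsPurification ψ ρ →
    Φ (tensorPow n ρ) = haarMean fun U : Matrix.unitaryGroup d ℂ =>
      regroup (tensorPow n
        (((1 : Matrix d d ℂ) ⊗ₖ (U : Matrix d d ℂ)) * ketbra ψ *
          ((1 : Matrix d d ℂ) ⊗ₖ (U : Matrix d d ℂ)ᴴ)))

/-- `ψ` is a permutationally symmetric purification of `ρ`, an operator on `A^{⊗n}`: it is a
purification in `A^{⊗n} ⊗ B^{⊗n}` which lies in the symmetric subspace of `(A ⊗ B)^{⊗n}`, i.e.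
`(P_π ⊗ P_π) ψ = ψ` for all `π`. -/
def IsSymmPurification {n : ℕ} (ψ : (Fin n → d) × (Fin n → d) → ℂ)
    (ρ : Matrix (Fin n → d) (Fin n → d) ℂ) : Prop :=
  IsPurification ψ ρ ∧ ∀ π : Equiv.Perm (Fin n),
    ((permMatrix π : Matrix (Fin n → d) (Fin n → d) ℂ) ⊗ₖ
      (permMatrix π : Matrix (Fin n → d) (Fin n → d) ℂ)) *ᵥ ψ = ψ

end Channel

section Schur

/-- The representation on `ℂ^k` given by a matrix-valued homomorphism. -/
noncomputable def matRep {G : Type*} [Monoid G] {k : ℕ}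
    (f : G →* Matrix (Fin k) (Fin k) ℂ) : Representation ℂ G (Fin k → ℂ) :=
  ((Matrix.toLinAlgEquiv' : Matrix (Fin k) (Fin k) ℂ ≃ₐ[ℂ] _) :
    Matrix (Fin k) (Fin k) ℂ →* ((Fin k → ℂ) →ₗ[ℂ] (Fin k → ℂ))).comp f

/-- A Schur transform: a unitary `W` from `(ℂ^d)^{⊗n}` onto `⨁_l Q_l ⊗ P_l`, with `Q_l = ℂ^{q l}`
and `P_l = ℂ^{p l}`, under which `P_π` becomes `⨁_l 1 ⊗ permRep l π` and `U^{⊗n}` becomes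
`⨁_l unitaryRep l U ⊗ 1`, where the `permRep l` are pairwise inequivalent irreducible
representations of `S_n` and the `unitaryRep l` pairwise inequivalent irreducible representations
of `U(d)`. -/
structure SchurTransform (d : Type*) [Fintype d] [DecidableEq d] (n : ℕ)
    (L : Type) [Fintype L] [DecidableEq L] (q p : L → ℕ) where
  W : Matrix (Σ l, Fin (q l) × Fin (p l)) (Fin n → d) ℂ
  W_mul_conjTranspose : W * Wᴴ = 1
  conjTranspose_mul_W : Wᴴ * W = 1
  permRep : ∀ l, Equiv.Perm (Fin n) →* Matrix (Fin (p l)) (Fin (p l)) ℂ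
  unitaryRep : ∀ l, Matrix.unitaryGroup d ℂ →* Matrix (Fin (q l)) (Fin (q l)) ℂ
  permRep_irreducible : ∀ l, (matRep (permRep l)).IsIrreducible
  unitaryRep_irreducible : ∀ l, (matRep (unitaryRep l)).IsIrreducible
  permRep_inequivalent : ∀ l l', l ≠ l' →
    IsEmpty (Representation.Equiv (matRep (permRep l)) (matRep (permRep l')))
  unitaryRep_inequivalent : ∀ l l', l ≠ l' →
    IsEmpty (Representation.Equiv (matRep (unitaryRep l)) (matRep (unitaryRep l')))
  W_perm : ∀ π : Equiv.Perm (Fin n), W * (permMatrix π : Matrix (Fin n → d) (Fin n → d) ℂ) * Wᴴ =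
    Matrix.blockDiagonal' fun l => (1 : Matrix (Fin (q l)) (Fin (q l)) ℂ) ⊗ₖ permRep l π
  W_unitary : ∀ U : Matrix.unitaryGroup d ℂ, W * tensorPow n (U : Matrix d d ℂ) * Wᴴ =
    Matrix.blockDiagonal' fun l => unitaryRep l U ⊗ₖ (1 : Matrix (Fin (p l)) (Fin (p l)) ℂ)

variable {d : Type*} [Fintype d] [DecidableEq d] {n : ℕ}
  {L : Type} [Fintype L] [DecidableEq L] {q p : L → ℕ}

/-- The `l`-th block row of the Schur transform, a co-isometry onto `Q_l ⊗ P_l`. -/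
def SchurTransform.block (S : SchurTransform d n L q p) (l : L) :
    Matrix (Fin (q l) × Fin (p l)) (Fin n → d) ℂ :=
  S.W.submatrix (fun x => ⟨l, x⟩) id

/-- `S` and `T` are dual: the matrices by which `S_n` acts on the `P_l` are complex conjugate, so
that the maximally entangled vector of `P_l ⊗ P_l` is invariant. A Schur transform in which these
matrices are real (such as those of Young's orthogonal form) is dual to itself. -/
def SchurTransform.IsDual (S T : SchurTransform d n L q p) : Prop :=
  ∀ l π, T.permRep l π = (S.permRep l π).map star

/-- The maximally mixed state on `ℂ^k`. -/
noncomputable def maxMixed (k : ℕ) : Matrix (Fin k) (Fin k) ℂ := (k : ℂ)⁻¹ • 1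

/-- The normalised maximally entangled state on `ℂ^k ⊗ ℂ^k`. -/
noncomputable def maxEntangled (k : ℕ) : Matrix (Fin k × Fin k) (Fin k × Fin k) ℂ :=
  (k : ℂ)⁻¹ • ketbra (gammaVec (Fin k))

/-- The state `Y ⊗ (1/q) ⊗ Φ⁺` on `(Q ⊗ P) ⊗ (Q ⊗ P)`: `Y` on the first `Q`, the maximally mixed
state on the second `Q`, and the maximally entangled state on the two copies of `P`. -/
noncomputable def prepare (q p : ℕ) (Y : Matrix (Fin q) (Fin q) ℂ) :
    Matrix ((Fin q × Fin p) × (Fin q × Fin p)) ((Fin q × Fin p) × (Fin q × Fin p)) ℂ :=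
  Matrix.of fun x y => Y x.1.1 y.1.1 * maxMixed q x.2.1 y.2.1 *
    maxEntangled p (x.1.2, x.2.2) (y.1.2, y.2.2)

/-- The channel of Tang, Wright and Zhandry: apply the Schur transform `S` to `A^{⊗n}`, measure the
label `l`, discard the register `P_l`, prepare the maximally mixed state on a second copy of `Q_l`
and the maximally entangled state on two fresh copies of `P_l`, and apply the inverse Schur
transforms `S⁻¹` and `T⁻¹` to obtain a state on `A^{⊗n} ⊗ B^{⊗n}`. -/
noncomputable def schurPurify (S T : SchurTransform d n L q p)
    (X : Matrix (Fin n → d) (Fin n → d) ℂ) :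
    Matrix ((Fin n → d) × (Fin n → d)) ((Fin n → d) × (Fin n → d)) ℂ :=
  ∑ l, (S.block l ⊗ₖ T.block l)ᴴ * prepare (q l) (p l) (traceSnd (S.block l * X * (S.block l)ᴴ)) *
    (S.block l ⊗ₖ T.block l)

end Schur

end RandomPurification

/-! A vector of `A^{⊗n} ⊗ B^{⊗n}` is replaced by its coefficient matrix `C`. Then `M ⊗ N` acts as `C
↦ M C Nᵀ`, purifying `ρ` means `C Cᴴ = ρ`, and lying in the symmetric subspace means that `C`
commutes with every `P_π` (`isSymmPurification_iff`). Every vector is `(C ⊗ 1)|Γ⟩`, so the Haar mean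
of its orbit under `1 ⊗ U^{⊗n}` is `(C ⊗ 1) R (C ⊗ 1)ᴴ`.

Invariance of Haar measure makes `R` commute with all `V^{⊗n} ⊗ 1` and `1 ⊗ V^{⊗n}`. The `V^{⊗n}`
span the operators commuting with all `P_π` (`mem_span_tensorPow_unitary`). Hence for symmetric `C`
the operator `C ⊗ 1` commutes with `R`, therefore with `√R`, and the mean equals `√R (C Cᴴ ⊗ 1) √R =
Λ(ρ)` (`purify_eq_haarMean`). Product purifications are the special case of a tensor power `C`.
Trace preservation is `traceSnd_R`, and invariance under permutations holds because `P_π ⊗ P_π`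
fixes `R`. Uniqueness follows because an invariant map is determined on symmetric operators, and
these are spanned by `ρ^{⊗n}` with `ρ ≥ 0`.

Both spanning statements come from `mem_span_tensorPow`: a functional that vanishes on tensor powers
is a polynomial identity in the matrix entries, and a polynomial vanishing on all `V diag(z) V†`,
with the entries of `z` in an infinite set, is zero.

For dual Schur transforms, Schur's lemma shows that the symmetric subspace is the sum of the ranges
of operators `E_l` (`entangler`) on `Q_l ⊗ Q_l`, with `E_lᴴ E_l = p_l`. Commutation makes `R` scalar
on each of them and `traceSnd_R` fixes the scalar: `R = ∑ q_l⁻¹ E_l E_lᴴ`. Its root is then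
explicit, and `Λ(X)` becomes the measure-and-prepare map. A dual pair is built by decomposing the
permutation representation into irreducibles and conjugating the resulting unitary; the
representations of `U(d)` on the multiplicity spaces are irreducible by the spanning theorem. -/

open scoped Matrix Kronecker ComplexOrder MatrixOrder

set_option linter.unusedSectionVars false

namespace RandomPurification

/-! ### Tensor powers of matrices and vectors -/

section TensorPower

variable {a b m : Type*} {n : ℕ}

lemma tensorPow_apply (M : Matrix m m ℂ) (i j : Fin n → m) :
    tensorPow n M i j = ∏ k, M (i k) (j k) := rfl

lemma tensorPow_mul [Fintype m] (M N : Matrix m m ℂ) :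
    tensorPow n (M * N) = tensorPow n M * tensorPow n N := by
  ext i j
  simp only [tensorPow_apply, Matrix.mul_apply, ← Finset.prod_mul_distrib]
  rw [Finset.prod_univ_sum, Fintype.piFinset_univ]

lemma tensorPow_one [DecidableEq m] : tensorPow n (1 : Matrix m m ℂ) = 1 := by
  ext i j
  simp only [tensorPow_apply, Matrix.one_apply, Finset.prod_ite_zero, Finset.prod_const_one,
    funext_iff, Finset.mem_univ, true_imp_iff]

lemma conjTranspose_tensorPow (M : Matrix m m ℂ) : (tensorPow n M)ᴴ = tensorPow n Mᴴ := by
  ext i j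
  simp [tensorPow_apply, Matrix.conjTranspose_apply]

lemma transpose_tensorPow (M : Matrix m m ℂ) : (tensorPow n M)ᵀ = tensorPow n Mᵀ := rfl

lemma tensorPow_smul (c : ℂ) (M : Matrix m m ℂ) :
    tensorPow n (c • M) = c ^ n • tensorPow n M := by
  ext i j
  simp [tensorPow_apply, Finset.prod_mul_distrib]

lemma tensorPow_unitary_mul_conjTranspose [Fintype m] [DecidableEq m]
    (U : Matrix.unitaryGroup m ℂ) :
    tensorPow n (U : Matrix m m ℂ) * (tensorPow n (U : Matrix m m ℂ))ᴴ = 1 := by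
  rw [conjTranspose_tensorPow, ← tensorPow_mul, ← Matrix.star_eq_conjTranspose,
    Unitary.mul_star_self_of_mem U.2, tensorPow_one]

lemma conjTranspose_mul_tensorPow_unitary [Fintype m] [DecidableEq m]
    (U : Matrix.unitaryGroup m ℂ) :
    (tensorPow n (U : Matrix m m ℂ))ᴴ * tensorPow n (U : Matrix m m ℂ) = 1 := by
  rw [conjTranspose_tensorPow, ← tensorPow_mul, ← Matrix.star_eq_conjTranspose,
    Unitary.star_mul_self_of_mem U.2, tensorPow_one]

lemma regroup_tensorPow_kronecker (M : Matrix a a ℂ) (N : Matrix b b ℂ) :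
    regroup (tensorPow n (M ⊗ₖ N)) = tensorPow n M ⊗ₖ tensorPow n N := by
  ext ⟨i, i'⟩ ⟨j, j'⟩
  simp [regroup, tensorPow_apply, Matrix.kroneckerMap_apply, Finset.prod_mul_distrib]

lemma regroup_mul [Fintype a] [Fintype b] (X Y : Matrix (Fin n → a × b) (Fin n → a × b) ℂ) :
    regroup (X * Y) = regroup X * regroup Y :=
  Matrix.submatrix_mul X Y _ _ _
    (Equiv.arrowProdEquivProdArrow (Fin n) (fun _ => a) (fun _ => b)).symm.bijective

lemma tensorPow_ketbra (ψ : a → ℂ) :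
    tensorPow n (ketbra ψ) = ketbra fun i : Fin n → a => ∏ k, ψ (i k) := by
  ext i j
  simp [tensorPow_apply, ketbra, Matrix.vecMulVec_apply, Finset.prod_mul_distrib]

lemma regroup_tensorPow_ketbra (ψ : a × b → ℂ) :
    regroup (tensorPow n (ketbra ψ)) =
      ketbra fun x : (Fin n → a) × (Fin n → b) => ∏ k, ψ (x.1 k, x.2 k) := by
  rw [tensorPow_ketbra]
  rfl

lemma mul_ketbra_mul_conjTranspose [Fintype a] (M : Matrix b a ℂ) (ψ : a → ℂ) :
    M * ketbra ψ * Mᴴ = ketbra (M *ᵥ ψ) := by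
  rw [ketbra, ketbra, Matrix.mul_vecMulVec, Matrix.vecMulVec_mul, Matrix.star_mulVec]

lemma prod_gammaVec [DecidableEq m] [Fintype m] (x : (Fin n → m) × (Fin n → m)) :
    ∏ k, gammaVec m (x.1 k, x.2 k) = gammaVec (Fin n → m) x := by
  simp only [gammaVec, Finset.prod_ite_zero, Finset.prod_const_one, funext_iff, Finset.mem_univ,
    true_imp_iff]

end TensorPower

/-! ### The action of the symmetric group on tensor factors -/

section Permutations

variable {m : Type*} [DecidableEq m] {n : ℕ}

lemma permMatrix_mul_apply [Fintype m] {r : Type*} (π : Equiv.Perm (Fin n)) (X : Matrix (Fin n → m) r ℂ)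
    (i : Fin n → m) (j : r) :
    ((permMatrix π : Matrix (Fin n → m) (Fin n → m) ℂ) * X : Matrix (Fin n → m) r ℂ) i j = X (i ∘ π) j := by
  rw [Matrix.mul_apply, Finset.sum_eq_single (i ∘ π)]
  · have : i = (i ∘ π) ∘ ⇑π⁻¹ := by ext; simp
    rw [permMatrix, Matrix.of_apply, if_pos this, one_mul]
  · intro k _ hk
    have : ¬ i = k ∘ ⇑π⁻¹ := by
      rintro rfl
      exact hk (by ext; simp)
    rw [permMatrix, Matrix.of_apply, if_neg this, zero_mul]
  · simp

lemma permMatrix_one : permMatrix (m := m) (1 : Equiv.Perm (Fin n)) = 1 := by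
  ext i j
  simp [permMatrix, Matrix.one_apply]

lemma permMatrix_mul [Fintype m] (π σ : Equiv.Perm (Fin n)) :
    permMatrix (m := m) (π * σ) = permMatrix (m := m) π * permMatrix σ := by
  ext i j
  rw [permMatrix_mul_apply]
  have : i = j ∘ ⇑(π * σ)⁻¹ ↔ i ∘ π = j ∘ ⇑σ⁻¹ :=
    ⟨by rintro rfl; ext; simp, fun h => by
      have h' := congrArg (· ∘ ⇑π⁻¹) h
      ext k
      simpa using congrFun h' k⟩
  simp only [permMatrix, Matrix.of_apply, this]

lemma permMatrix_transpose (π : Equiv.Perm (Fin n)) :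
    (permMatrix (m := m) π)ᵀ = permMatrix π⁻¹ := by
  ext i j
  have : j = i ∘ ⇑π⁻¹ ↔ i = j ∘ ⇑(π⁻¹)⁻¹ :=
    ⟨by rintro rfl; ext; simp, by rintro rfl; ext; simp⟩
  simp only [permMatrix, Matrix.transpose_apply, Matrix.of_apply, this]

lemma permMatrix_map_star (π : Equiv.Perm (Fin n)) :
    (permMatrix (m := m) π).map star = permMatrix π := by
  ext i j
  simp only [permMatrix, Matrix.map_apply, Matrix.of_apply]
  split <;> simp

lemma permMatrix_conjTranspose (π : Equiv.Perm (Fin n)) :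
    (permMatrix (m := m) π)ᴴ = permMatrix π⁻¹ := by
  rw [Matrix.conjTranspose, permMatrix_transpose, permMatrix_map_star]

variable [Fintype m]

lemma permMatrix_mul_inv (π : Equiv.Perm (Fin n)) :
    permMatrix (m := m) π * permMatrix π⁻¹ = 1 := by
  rw [← permMatrix_mul, mul_inv_cancel, permMatrix_one]

lemma permMatrix_inv_mul (π : Equiv.Perm (Fin n)) :
    permMatrix (m := m) π⁻¹ * permMatrix π = 1 := by
  rw [← permMatrix_mul, inv_mul_cancel, permMatrix_one]

variable (m n) in
/-- The representation of `S_n` on `(ℂ^m)^{⊗n}`. -/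
def permHom : Equiv.Perm (Fin n) →* Matrix (Fin n → m) (Fin n → m) ℂ where
  toFun := permMatrix
  map_one' := permMatrix_one
  map_mul' := permMatrix_mul

lemma permMatrix_conj_apply (π : Equiv.Perm (Fin n)) (X : Matrix (Fin n → m) (Fin n → m) ℂ)
    (i j : Fin n → m) :
    ((permMatrix π : Matrix (Fin n → m) (Fin n → m) ℂ) * X * (permMatrix π)ᴴ : Matrix (Fin n → m) (Fin n → m) ℂ) i j =
      X (i ∘ π) (j ∘ π) := by
  rw [mul_assoc, permMatrix_mul_apply, permMatrix_conjTranspose, ← Matrix.transpose_apply (_ * _),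
    Matrix.transpose_mul, permMatrix_transpose, inv_inv, permMatrix_mul_apply,
    Matrix.transpose_apply]

lemma isPermSymmetric_iff_apply {X : Matrix (Fin n → m) (Fin n → m) ℂ} :
    IsPermSymmetric X ↔ ∀ (π : Equiv.Perm (Fin n)) i j, X (i ∘ π) (j ∘ π) = X i j := by
  simp only [IsPermSymmetric, ← Matrix.ext_iff, permMatrix_conj_apply]

lemma isPermSymmetric_iff_commute {X : Matrix (Fin n → m) (Fin n → m) ℂ} :
    IsPermSymmetric X ↔ ∀ π : Equiv.Perm (Fin n), Commute (permMatrix π) X := by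
  refine forall_congr' fun π => ⟨fun h => ?_, fun h => ?_⟩
  · rw [commute_iff_eq]
    conv_rhs => rw [← h]
    rw [mul_assoc, permMatrix_conjTranspose, permMatrix_inv_mul, mul_one]
  · rw [h.eq, mul_assoc, permMatrix_conjTranspose, permMatrix_mul_inv, mul_one]

lemma isPermSymmetric_tensorPow (M : Matrix m m ℂ) : IsPermSymmetric (tensorPow n M) := by
  rw [isPermSymmetric_iff_apply]
  intro π i j
  exact Equiv.prod_comp π fun k => M (i k) (j k)

/-- The average of an operator over the permutations of the tensor factors. -/
noncomputable def permTwirl (X : Matrix (Fin n → m) (Fin n → m) ℂ) :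
    Matrix (Fin n → m) (Fin n → m) ℂ :=
  (Fintype.card (Equiv.Perm (Fin n)) : ℂ)⁻¹ •
    ∑ π : Equiv.Perm (Fin n), (permMatrix π : Matrix (Fin n → m) (Fin n → m) ℂ) * X * (permMatrix π)ᴴ

lemma isPermSymmetric_permTwirl (X : Matrix (Fin n → m) (Fin n → m) ℂ) :
    IsPermSymmetric (permTwirl X) := by
  rw [isPermSymmetric_iff_apply]
  intro σ i j
  simp only [permTwirl, Matrix.smul_apply, Matrix.sum_apply, permMatrix_conj_apply]
  congr 1
  exact Equiv.sum_comp (Equiv.mulLeft σ) fun π => X (i ∘ π) (j ∘ π)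

lemma map_permTwirl {E : Type*} [AddCommGroup E] [Module ℂ E]
    (Φ : Matrix (Fin n → m) (Fin n → m) ℂ →ₗ[ℂ] E)
    (hΦ : ∀ (π : Equiv.Perm (Fin n)) X, Φ ((permMatrix π : Matrix (Fin n → m) (Fin n → m) ℂ) * X * (permMatrix π)ᴴ) = Φ X)
    (X : Matrix (Fin n → m) (Fin n → m) ℂ) : Φ (permTwirl X) = Φ X := by
  rw [permTwirl, map_smul, map_sum, Finset.sum_congr rfl fun π _ => hΦ π X, Finset.sum_const,
    Finset.card_univ, ← Nat.cast_smul_eq_nsmul ℂ, smul_smul, inv_mul_cancel₀, one_smul]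
  exact_mod_cast Fintype.card_ne_zero

end Permutations

/-! ### Tensor powers span the symmetric operators -/

section Polynomials

variable {ι : Type*} {m : Type*} {n : ℕ}

/-- The monomial `∏ k, X (w k)`. -/
noncomputable def wordExponent (w : Fin n → ι) : ι →₀ ℕ := ∑ k, Finsupp.single (w k) 1

/-- The exponent of a letter is the size of its fibre, so bijections between fibres of equal size
glue to a permutation of the positions. -/
lemma exists_perm_of_wordExponent_eq [DecidableEq ι] {v w : Fin n → ι}
    (h : wordExponent v = wordExponent w) : ∃ π : Equiv.Perm (Fin n), w ∘ π = v := by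
  have hc : ∀ (u : Fin n → ι) c, wordExponent u c = Fintype.card {k // u k = c} := by
    intro u c
    simp [wordExponent, Finsupp.finsetSum_apply, Finsupp.single_apply, Fintype.card_subtype]
  have e : ∀ c, {k // v k = c} ≃ {k // w k = c} := fun c =>
    Fintype.equivOfCardEq (by rw [← hc, ← hc, h])
  exact ⟨Equiv.ofFiberEquiv e, funext fun k => Equiv.ofFiberEquiv_map e k⟩

variable [Fintype m]

/-- The polynomial `M ↦ ∑ i j, c i j * (M^{⊗n}) i j` in the entries of `M`. -/
noncomputable def tensorPoly (c : (Fin n → m) → (Fin n → m) → ℂ) : MvPolynomial (m × m) ℂ :=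
  ∑ x : (Fin n → m) × (Fin n → m),
    MvPolynomial.monomial (wordExponent fun k => (x.1 k, x.2 k)) (c x.1 x.2)

lemma eval_tensorPoly (c : (Fin n → m) → (Fin n → m) → ℂ) (M : Matrix m m ℂ) :
    MvPolynomial.eval (fun x => M x.1 x.2) (tensorPoly c) =
      ∑ x : (Fin n → m) × (Fin n → m), tensorPow n M x.1 x.2 * c x.1 x.2 := by
  rw [tensorPoly, map_sum]
  refine Finset.sum_congr rfl fun x _ => ?_
  rw [MvPolynomial.eval_monomial, mul_comm, wordExponent]
  congr 1
  rw [← Finsupp.prod_finsetSum_index (by simp) (by intros; rw [pow_add])]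
  simp [tensorPow_apply, Finsupp.prod_single_index]

variable [DecidableEq m]

/-- A polynomial function of a matrix which vanishes on the matrices `V diag(z) V†` with `V` unitary
and the entries of `z` in an infinite set vanishes. -/
lemma eq_zero_of_eval_unitary_diagonal {s : Set ℂ} (hs : s.Infinite)
    {p : MvPolynomial (m × m) ℂ}
    (h : ∀ (V : Matrix.unitaryGroup m ℂ) (z : m → ℂ), (∀ i, z i ∈ s) →
      MvPolynomial.eval (fun x => ((V : Matrix m m ℂ) * Matrix.diagonal z *
        (V : Matrix m m ℂ)ᴴ) x.1 x.2) p = 0) : p = 0 := by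
  have eval_bind : ∀ {τ : Type _} (g : m × m → MvPolynomial τ ℂ) (y : τ → ℂ),
      MvPolynomial.eval y (MvPolynomial.bind₁ g p) =
        MvPolynomial.eval (fun x => MvPolynomial.eval y (g x)) p := by
    intro τ g y
    exact MvPolynomial.eval₂Hom_bind₁ _ _ _ _
  -- For fixed `V` this is a polynomial in `z` vanishing on a product of infinite sets, so arbitrary
  -- eigenvalues are allowed.
  have h1 : ∀ (V : Matrix.unitaryGroup m ℂ) (z : m → ℂ),
      MvPolynomial.eval (fun x => ((V : Matrix m m ℂ) * Matrix.diagonal z *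
        (V : Matrix m m ℂ)ᴴ) x.1 x.2) p = 0 := by
    intro V z
    let g : m × m → MvPolynomial m ℂ := fun x =>
      ∑ e, MvPolynomial.C ((V : Matrix m m ℂ) x.1 e * star ((V : Matrix m m ℂ) x.2 e)) *
        MvPolynomial.X e
    have hg : ∀ y : m → ℂ, (fun x => MvPolynomial.eval y (g x)) = fun x =>
        ((V : Matrix m m ℂ) * Matrix.diagonal y * (V : Matrix m m ℂ)ᴴ) x.1 x.2 := by
      intro y
      ext x
      simp only [g, map_sum, map_mul, MvPolynomial.eval_C, MvPolynomial.eval_X,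
        Matrix.mul_apply (N := (V : Matrix m m ℂ)ᴴ), Matrix.mul_diagonal, Matrix.conjTranspose_apply]
      exact Finset.sum_congr rfl fun e _ => by ring
    have h0 : MvPolynomial.bind₁ g p = 0 := by
      refine MvPolynomial.funext_set (fun _ => s) (fun _ => hs) fun y hy => ?_
      rw [eval_bind, hg, map_zero]
      exact h V y fun i => hy i trivial
    rw [← hg, ← eval_bind, h0, map_zero]
  have h2 : ∀ H : Matrix m m ℂ, H.IsHermitian →
      MvPolynomial.eval (fun x => H x.1 x.2) p = 0 := by
    intro H hH
    have := hH.spectral_theorem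
    rw [Unitary.conjStarAlgAut_apply] at this
    rw [this]
    exact h1 _ _
  -- A linear change of coordinates under which real points become Hermitian matrices. The pulled
  -- back polynomial vanishes at all real points, hence identically; the inverse change `y` below
  -- then reaches every complex matrix.
  let g : m × m → MvPolynomial (m × m) ℂ := fun x =>
    MvPolynomial.C (1 / 2) * (MvPolynomial.X x + MvPolynomial.X x.swap) +
      MvPolynomial.C (Complex.I / 2) * (MvPolynomial.X x - MvPolynomial.X x.swap)
  have h3 : MvPolynomial.bind₁ g p = 0 := by
    refine MvPolynomial.funext_set (fun _ => Set.range ((↑) : ℝ → ℂ))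
      (fun _ => Set.infinite_range_of_injective Complex.ofReal_injective) fun y hy => ?_
    rw [eval_bind, map_zero]
    refine h2 (Matrix.of fun i j => MvPolynomial.eval y (g (i, j))) ?_
    have hy' : ∀ x, star (y x) = y x := by
      intro x
      obtain ⟨r, hr⟩ := hy x trivial
      rw [← hr]
      exact Complex.conj_ofReal r
    ext i j
    have hI : (starRingEnd ℂ) Complex.I = -Complex.I := Complex.conj_I
    simp only [starRingEnd_apply] at hI
    simp only [g, Matrix.conjTranspose_apply, Matrix.of_apply, map_add, map_sub, map_mul,
      MvPolynomial.eval_C, MvPolynomial.eval_X, Prod.swap_prod_mk, star_add, star_mul', star_sub,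
      hy', star_div₀, star_one, star_ofNat, hI]
    ring
  refine MvPolynomial.funext fun M => ?_
  rw [map_zero]
  let y : m × m → ℂ := fun x => (M x + M x.swap) / 2 - Complex.I * (M x - M x.swap) / 2
  have hy : (fun x => MvPolynomial.eval y (g x)) = M := by
    ext x
    simp only [g, y, map_add, map_sub, map_mul, MvPolynomial.eval_C, MvPolynomial.eval_X,
      Prod.swap_swap]
    linear_combination (-(M x - M x.swap) / 2) * Complex.I_sq
  rw [← hy, ← eval_bind, h3, map_zero]

/-- The symmetric operators on `(ℂ^m)^{⊗n}` are spanned by the tensor powers `M^{⊗n}` of the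
normal matrices `M` with eigenvalues in a given infinite set. -/
theorem mem_span_tensorPow {s : Set ℂ} (hs : s.Infinite)
    {X : Matrix (Fin n → m) (Fin n → m) ℂ} (hX : IsPermSymmetric X) :
    X ∈ Submodule.span ℂ {Y | ∃ (V : Matrix.unitaryGroup m ℂ) (z : m → ℂ), (∀ i, z i ∈ s) ∧
      tensorPow n ((V : Matrix m m ℂ) * Matrix.diagonal z * (V : Matrix m m ℂ)ᴴ) = Y} := by
  classical
  by_contra hc
  -- Separate `X` from the span by a functional. On tensor powers the functional is a polynomial in
  -- the matrix entries, which must be the zero polynomial.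
  obtain ⟨f, hf, hle⟩ := Submodule.exists_le_ker_of_notMem hc
  let c : (Fin n → m) → (Fin n → m) → ℂ := fun i j => f (Matrix.single i j 1)
  have hfc : ∀ Y, f Y = ∑ x : (Fin n → m) × (Fin n → m), Y x.1 x.2 * c x.1 x.2 := by
    intro Y
    conv_lhs => rw [Matrix.matrix_eq_sum_single Y]
    rw [Fintype.sum_prod_type]
    simp only [map_sum, c]
    refine Finset.sum_congr rfl fun i _ => Finset.sum_congr rfl fun j _ => ?_
    rw [← smul_eq_mul, ← map_smul, Matrix.smul_single, smul_eq_mul, mul_one]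
  have hp : tensorPoly c = 0 := by
    refine eq_zero_of_eval_unitary_diagonal hs fun V z hz => ?_
    rw [eval_tensorPoly, ← hfc]
    exact hle (Submodule.subset_span ⟨V, z, hz, rfl⟩)
  apply hf
  -- Index pairs are grouped by their monomial. Within a group they differ by a permutation of
  -- positions, so `X` is constant there, while the values of `c` add up to a coefficient of the
  -- zero polynomial.
  let e : (Fin n → m) × (Fin n → m) → (m × m →₀ ℕ) := fun x =>
    wordExponent fun k => (x.1 k, x.2 k)
  rw [hfc, ← Finset.sum_fiberwise_of_maps_to (g := e)
    (t := Finset.univ.image e) (fun x _ => Finset.mem_image_of_mem e (Finset.mem_univ x))]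
  refine Finset.sum_eq_zero fun u hu => ?_
  obtain ⟨y, -, rfl⟩ := Finset.mem_image.mp hu
  have hcoeff : ∑ x with e x = e y, c x.1 x.2 = 0 := by
    have := congrArg (MvPolynomial.coeff (e y)) hp
    rw [tensorPoly, MvPolynomial.coeff_sum, MvPolynomial.coeff_zero] at this
    rw [Finset.sum_filter]
    refine Eq.trans (Finset.sum_congr rfl fun x _ => ?_) this
    exact (MvPolynomial.coeff_monomial _ _ _).symm
  rw [← mul_zero (X y.1 y.2), ← hcoeff, Finset.mul_sum]
  refine Finset.sum_congr rfl fun x hx => ?_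
  obtain ⟨π, hπ⟩ := exists_perm_of_wordExponent_eq (Finset.mem_filter.mp hx).2
  congr 1
  rw [← isPermSymmetric_iff_apply.mp hX π y.1 y.2]
  congr 1 <;> ext k
  · exact (congrArg Prod.fst (congrFun hπ k)).symm
  · exact (congrArg Prod.snd (congrFun hπ k)).symm

end Polynomials

/-! ### Haar measure on the unitary group and matrix-valued means -/

section HaarMean

open MeasureTheory

variable {d : Type*} [Fintype d] [DecidableEq d]

instance : (haarU d).IsHaarMeasure := by
  unfold haarU
  infer_instance

instance : IsProbabilityMeasure (haarU d) :=
  ⟨Measure.haarMeasure_self (G := Matrix.unitaryGroup d ℂ) (K₀ := ⊤)⟩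

/-- Unimodularity by uniqueness: a right translate of Haar measure is still left invariant, hence a
multiple of it, and both have total mass 1. -/
instance : (haarU d).IsMulRightInvariant := ⟨fun g => by
  have hm : Measurable (· * g : Matrix.unitaryGroup d ℂ → Matrix.unitaryGroup d ℂ) :=
    (continuous_mul_const g).measurable
  have : IsProbabilityMeasure ((haarU d).map (· * g)) :=
    Measure.isProbabilityMeasure_map hm.aemeasurable
  have h := Measure.isMulInvariant_eq_smul_of_compactSpace ((haarU d).map (· * g)) (haarU d)
  have h1 := congrArg (fun μ => μ Set.univ) h
  simp only [measure_univ, Measure.smul_apply, ENNReal.smul_def, smul_eq_mul, mul_one] at h1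
  rw [h, ENNReal.coe_eq_one.mp h1.symm, one_smul]⟩

variable {a b : Type*} [Fintype a] [Fintype b]

lemma integrable_of_continuous {F : Matrix.unitaryGroup d ℂ → ℂ} (hF : Continuous F) :
    Integrable F (haarU d) :=
  hF.integrable_of_hasCompactSupport (HasCompactSupport.of_compactSpace F)

lemma haarMean_apply (F : Matrix.unitaryGroup d ℂ → Matrix a a ℂ) (i j : a) :
    haarMean F i j = ∫ U, F U i j ∂(haarU d) := rfl

lemma integral_linear {F : Matrix.unitaryGroup d ℂ → Matrix a a ℂ} (hF : Continuous F)
    (L : Matrix a a ℂ →ₗ[ℂ] ℂ) : ∫ U, L (F U) ∂(haarU d) = L (haarMean F) := by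
  classical
  have hL : ∀ Y, L Y = ∑ i, ∑ j, Y i j * L (Matrix.single i j 1) := by
    intro Y
    conv_lhs => rw [Matrix.matrix_eq_sum_single Y]
    simp only [map_sum]
    refine Finset.sum_congr rfl fun i _ => Finset.sum_congr rfl fun j _ => ?_
    rw [← smul_eq_mul, ← map_smul, Matrix.smul_single, smul_eq_mul, mul_one]
  have hi : ∀ i j, Integrable (fun U => F U i j * L (Matrix.single i j 1)) (haarU d) := fun i j =>
    (integrable_of_continuous (hF.matrix_elem i j)).mul_const _
  simp only [hL (F _), hL (haarMean F)]
  rw [integral_finsetSum _ fun i _ => integrable_finsetSum _ fun j _ => hi i j]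
  refine Finset.sum_congr rfl fun i _ => ?_
  rw [integral_finsetSum _ fun j _ => hi i j]
  exact Finset.sum_congr rfl fun j _ => integral_mul_const _ _

lemma haarMean_linear {F : Matrix.unitaryGroup d ℂ → Matrix a a ℂ} (hF : Continuous F)
    (L : Matrix a a ℂ →ₗ[ℂ] Matrix b b ℂ) : haarMean (fun U => L (F U)) = L (haarMean F) := by
  ext i j
  exact integral_linear hF (Matrix.entryLinearMap ℂ ℂ i j ∘ₗ L)

lemma haarMean_mul_mul {F : Matrix.unitaryGroup d ℂ → Matrix a a ℂ} (hF : Continuous F)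
    (M : Matrix b a ℂ) (N : Matrix a b ℂ) :
    haarMean (fun U => M * F U * N) = M * haarMean F * N :=
  haarMean_linear hF
    { toFun := fun X => M * X * N
      map_add' := fun X Y => by rw [Matrix.mul_add, Matrix.add_mul]
      map_smul' := fun c X => by simp }

lemma haarMean_mul {F : Matrix.unitaryGroup d ℂ → Matrix a a ℂ} (hF : Continuous F)
    (M : Matrix a a ℂ) : haarMean (fun U => M * F U) = M * haarMean F :=
  haarMean_linear hF (LinearMap.mulLeft ℂ M)

lemma haarMean_const (X : Matrix a a ℂ) :
    haarMean (fun _ : Matrix.unitaryGroup d ℂ => X) = X := by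
  ext i j
  simp [haarMean_apply]

lemma haarMean_comp_mul_left (F : Matrix.unitaryGroup d ℂ → Matrix a a ℂ)
    (V : Matrix.unitaryGroup d ℂ) : haarMean (fun U => F (V * U)) = haarMean F := by
  ext i j
  exact integral_mul_left_eq_self (fun U => F U i j) V

lemma haarMean_comp_mul_right (F : Matrix.unitaryGroup d ℂ → Matrix a a ℂ)
    (V : Matrix.unitaryGroup d ℂ) : haarMean (fun U => F (U * V)) = haarMean F := by
  ext i j
  exact integral_mul_right_eq_self (fun U => F U i j) V

/-- The value of the quadratic form at a fixed vector is linear in the matrix, so it passes through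
the mean and becomes the integral of a nonnegative function. -/
lemma haarMean_posSemidef {F : Matrix.unitaryGroup d ℂ → Matrix a a ℂ} (hF : Continuous F)
    (h : ∀ U, (F U).PosSemidef) : (haarMean F).PosSemidef := by
  refine Matrix.PosSemidef.of_dotProduct_mulVec_nonneg ?_ fun v => ?_
  · ext i j
    rw [Matrix.conjTranspose_apply, haarMean_apply, haarMean_apply, ← starRingEnd_apply,
      ← integral_conj]
    refine integral_congr_ae (Filter.Eventually.of_forall fun U => ?_)
    exact congrFun (congrFun (h U).1 i) j
  · let L : Matrix a a ℂ →ₗ[ℂ] ℂ :=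
      { toFun := fun X => star v ⬝ᵥ (X *ᵥ v)
        map_add' := fun X Y => by rw [Matrix.add_mulVec, dotProduct_add]
        map_smul' := fun c X => by simp [Matrix.smul_mulVec] }
    change 0 ≤ L (haarMean F)
    rw [← integral_linear hF]
    have hr : ∀ U, ((L (F U)).re : ℂ) = L (F U) := fun U =>
      Complex.ext rfl (Complex.nonneg_iff.mp ((h U).dotProduct_mulVec_nonneg v)).2
    rw [← integral_congr_ae (Filter.Eventually.of_forall hr), integral_complex_ofReal]
    exact Complex.zero_le_real.mpr (integral_nonneg fun U =>
      (Complex.nonneg_iff.mp ((h U).dotProduct_mulVec_nonneg v)).1)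

end HaarMean

/-! ### Bipartite vectors as coefficient matrices -/

section Vectorization

variable {a b : Type*} [Fintype a] [Fintype b]

/-- The matrix of coefficients of a vector in a tensor product. -/
def coeffMatrix (ψ : a × b → ℂ) : Matrix a b ℂ := Matrix.of fun i j => ψ (i, j)

lemma coeffMatrix_injective : Function.Injective (coeffMatrix (a := a) (b := b)) :=
  fun _ _ h => funext fun x => congrFun (congrFun h x.1) x.2

lemma coeffMatrix_kronecker_mulVec {a' b' : Type*} (M : Matrix a' a ℂ) (N : Matrix b' b ℂ)
    (ψ : a × b → ℂ) : coeffMatrix ((M ⊗ₖ N) *ᵥ ψ) = M * coeffMatrix ψ * Nᵀ := by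
  ext i j
  simp only [coeffMatrix, Matrix.of_apply, Matrix.mulVec, dotProduct, Fintype.sum_prod_type,
    Matrix.kroneckerMap_apply, Matrix.mul_apply, Matrix.transpose_apply, Finset.sum_mul]
  rw [Finset.sum_comm]
  exact Finset.sum_congr rfl fun k _ => Finset.sum_congr rfl fun l _ => by ring

lemma coeffMatrix_gammaVec [DecidableEq a] : coeffMatrix (gammaVec a) = 1 := by
  ext i j
  simp [coeffMatrix, gammaVec, Matrix.one_apply]

lemma traceSnd_ketbra (ψ : a × b → ℂ) :
    traceSnd (ketbra ψ) = coeffMatrix ψ * (coeffMatrix ψ)ᴴ := by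
  ext i j
  simp [traceSnd, ketbra, coeffMatrix, Matrix.mul_apply, Matrix.vecMulVec_apply]

/-- The vector `|Γ⟩` has coefficient matrix 1. Since `M ⊗ 1` commutes with `1 ⊗ U^{⊗n}`, this
reduces the Haar mean of any pure state to `R`. -/
lemma eq_kronecker_one_mulVec_gammaVec [DecidableEq a] (ψ : a × a → ℂ) :
    ψ = (coeffMatrix ψ ⊗ₖ (1 : Matrix a a ℂ)) *ᵥ gammaVec a := by
  apply coeffMatrix_injective
  rw [coeffMatrix_kronecker_mulVec, coeffMatrix_gammaVec, mul_one, Matrix.transpose_one, mul_one]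

lemma trace_kronecker_one_mul [DecidableEq b] (X : Matrix a a ℂ)
    (Y : Matrix (a × b) (a × b) ℂ) :
    ((X ⊗ₖ (1 : Matrix b b ℂ)) * Y).trace = (X * traceSnd Y).trace := by
  simp only [Matrix.trace, Matrix.diag, Matrix.mul_apply, Fintype.sum_prod_type,
    Matrix.kroneckerMap_apply, Matrix.one_apply, traceSnd, Matrix.of_apply, mul_ite, mul_one,
    mul_zero, ite_mul, zero_mul, Finset.sum_ite_eq, Finset.mem_univ, if_true, Finset.mul_sum]
  exact Finset.sum_congr rfl fun i _ => Finset.sum_comm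

/-- The partial trace as a linear map. -/
def traceSndLin : Matrix (a × b) (a × b) ℂ →ₗ[ℂ] Matrix a a ℂ where
  toFun := traceSnd
  map_add' X Y := by ext; simp [traceSnd, Finset.sum_add_distrib]
  map_smul' c X := by ext; simp [traceSnd, Finset.mul_sum]

end Vectorization

/-! ### Square roots and complete positivity -/

section SquareRoot

variable {a b : Type*} [Fintype a] [Fintype b] [DecidableEq a] [DecidableEq b]

lemma sqrt_isHermitian (X : Matrix a a ℂ) : (CFC.sqrt X)ᴴ = CFC.sqrt X :=
  (Matrix.nonneg_iff_posSemidef.mp (CFC.sqrt_nonneg X)).1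

lemma commute_sqrt {X Y : Matrix a a ℂ} (h : Commute X Y) : Commute X (CFC.sqrt Y) :=
  (h.symm.cfcₙ_nnreal _).symm

/-- The product of `(X - 1)√Y` with its adjoint is `(X - 1) Y (X - 1)ᴴ = 0`. -/
lemma mul_sqrt_eq_sqrt {X Y : Matrix a a ℂ} (hY : Y.PosSemidef) (h : X * Y = Y) :
    X * CFC.sqrt Y = CFC.sqrt Y := by
  rw [← sub_eq_zero, ← Matrix.self_mul_conjTranspose_eq_zero]
  have : X * CFC.sqrt Y - CFC.sqrt Y = (X - 1) * CFC.sqrt Y := by rw [sub_mul, one_mul]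
  rw [this, Matrix.conjTranspose_mul, sqrt_isHermitian, mul_assoc, ← mul_assoc (CFC.sqrt Y),
    CFC.sqrt_mul_sqrt_self Y hY.nonneg, ← mul_assoc, sub_mul, one_mul, h, sub_self, zero_mul]

/-- Tensoring with the identity, reindexing by `e` to move the ancilla past `b`, and conjugating by
`G ⊗ 1` all preserve positivity. -/
lemma isCompletelyPositive_kronecker_one
    (Φ : Matrix a a ℂ →ₗ[ℂ] Matrix (a × b) (a × b) ℂ) (G : Matrix (a × b) (a × b) ℂ)
    (hΦ : ∀ X, Φ X = G * (X ⊗ₖ (1 : Matrix b b ℂ)) * Gᴴ) : IsCompletelyPositive Φ := by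
  intro k X hX
  let e : (a × b) × Fin k → (a × Fin k) × b := fun x => ((x.1.1, x.2), x.1.2)
  have hY := ((hX.kronecker (Matrix.PosSemidef.one (n := b))).submatrix e).mul_mul_conjTranspose_same
    (G ⊗ₖ (1 : Matrix (Fin k) (Fin k) ℂ))
  refine (congrArg Matrix.PosSemidef ?_).mpr hY
  ext x y
  simp only [hΦ, Matrix.of_apply, Matrix.mul_apply, Matrix.conjTranspose_apply,
    Matrix.kroneckerMap_apply, Fintype.sum_prod_type (α₂ := Fin k), Matrix.submatrix_apply, e,
    Matrix.one_apply, mul_ite, ite_mul, mul_one, mul_zero, zero_mul, star_zero,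
    Finset.sum_ite_eq, Finset.mem_univ, if_true, apply_ite star, Finset.sum_ite_irrel,
    Finset.sum_const_zero]

end SquareRoot

/-! ### The local unitaries `1 ⊗ U^{⊗n}` -/

section LocalUnitaries

variable {d : Type*} [Fintype d] [DecidableEq d] {n : ℕ}

variable (n) in
/-- The operator `1 ⊗ U^{⊗n}` on `A^{⊗n} ⊗ B^{⊗n}`. -/
def localUnitary (U : Matrix.unitaryGroup d ℂ) :
    Matrix ((Fin n → d) × (Fin n → d)) ((Fin n → d) × (Fin n → d)) ℂ :=
  (1 : Matrix (Fin n → d) (Fin n → d) ℂ) ⊗ₖ tensorPow n (U : Matrix d d ℂ)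

lemma localUnitary_mul (U V : Matrix.unitaryGroup d ℂ) :
    localUnitary n (U * V) = localUnitary n U * localUnitary n V := by
  rw [localUnitary, localUnitary, localUnitary, ← Matrix.mul_kronecker_mul, one_mul,
    ← tensorPow_mul]
  rfl

lemma localUnitary_conjTranspose (U : Matrix.unitaryGroup d ℂ) :
    (localUnitary n U)ᴴ =
      (1 : Matrix (Fin n → d) (Fin n → d) ℂ) ⊗ₖ tensorPow n (U : Matrix d d ℂ)ᴴ := by
  rw [localUnitary, Matrix.conjTranspose_kronecker, Matrix.conjTranspose_one,
    conjTranspose_tensorPow]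

lemma localUnitary_mul_conjTranspose (U : Matrix.unitaryGroup d ℂ) :
    localUnitary n U * (localUnitary n U)ᴴ = 1 := by
  rw [localUnitary, Matrix.conjTranspose_kronecker, ← Matrix.mul_kronecker_mul,
    tensorPow_unitary_mul_conjTranspose, Matrix.conjTranspose_one, one_mul, Matrix.one_kronecker_one]

lemma localUnitary_conjTranspose_mul (U : Matrix.unitaryGroup d ℂ) :
    (localUnitary n U)ᴴ * localUnitary n U = 1 :=
  mul_eq_one_comm.mp (localUnitary_mul_conjTranspose U)

lemma kronecker_one_mul_localUnitary (M : Matrix (Fin n → d) (Fin n → d) ℂ)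
    (U : Matrix.unitaryGroup d ℂ) :
    (M ⊗ₖ (1 : Matrix (Fin n → d) (Fin n → d) ℂ)) * localUnitary n U =
      localUnitary n U * (M ⊗ₖ (1 : Matrix (Fin n → d) (Fin n → d) ℂ)) := by
  rw [localUnitary, ← Matrix.mul_kronecker_mul, ← Matrix.mul_kronecker_mul, one_mul, mul_one,
    mul_one, one_mul]

lemma continuous_localUnitary :
    Continuous (localUnitary n : Matrix.unitaryGroup d ℂ → _) := by
  refine continuous_matrix fun x y => ?_
  simp only [localUnitary, Matrix.kroneckerMap_apply, tensorPow_apply]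
  exact continuous_const.mul (continuous_finsetProd _ fun k _ =>
    continuous_subtype_val.matrix_elem _ _)

lemma continuous_localUnitary_conj
    (X : Matrix ((Fin n → d) × (Fin n → d)) ((Fin n → d) × (Fin n → d)) ℂ) :
    Continuous fun U : Matrix.unitaryGroup d ℂ =>
      localUnitary n U * X * (localUnitary n U)ᴴ :=
  (continuous_localUnitary.matrix_mul continuous_const).matrix_mul
    continuous_localUnitary.matrix_conjTranspose

lemma coeffMatrix_localUnitary_mulVec (U : Matrix.unitaryGroup d ℂ)
    (ψ : (Fin n → d) × (Fin n → d) → ℂ) :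
    coeffMatrix (localUnitary n U *ᵥ ψ) =
      coeffMatrix ψ * (tensorPow n (U : Matrix d d ℂ))ᵀ := by
  rw [localUnitary, coeffMatrix_kronecker_mulVec, one_mul]

lemma transpose_tensorPow_unitary_mul_conjTranspose (U : Matrix.unitaryGroup d ℂ) :
    (tensorPow n (U : Matrix d d ℂ))ᵀ * ((tensorPow n (U : Matrix d d ℂ))ᵀ)ᴴ = 1 := by
  rw [Matrix.conjTranspose_transpose_eq_transpose_conjTranspose, ← Matrix.transpose_mul,
    conjTranspose_mul_tensorPow_unitary, Matrix.transpose_one]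

end LocalUnitaries

/-! ### Symmetries and partial trace of `R` -/

section ROperator

variable {d : Type*} [Fintype d] [DecidableEq d] {n : ℕ}

lemma R_eq_haarMean : R d n = haarMean fun U : Matrix.unitaryGroup d ℂ =>
    localUnitary n U * ketbra (gammaVec (Fin n → d)) * (localUnitary n U)ᴴ := by
  rw [R]
  congr 1
  ext1 U
  rw [localUnitary_conjTranspose, localUnitary, regroup_tensorPow_ketbra]
  simp only [prod_gammaVec]

lemma R_posSemidef : (R d n).PosSemidef := by
  rw [R_eq_haarMean]
  refine haarMean_posSemidef (continuous_localUnitary_conj _) fun U => ?_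
  exact (Matrix.posSemidef_vecMulVec_self_star _).mul_mul_conjTranspose_same _

lemma sqrt_R_mul_self : CFC.sqrt (R d n) * CFC.sqrt (R d n) = R d n :=
  CFC.sqrt_mul_sqrt_self _ R_posSemidef.nonneg

lemma R_isHermitian : (R d n)ᴴ = R d n := R_posSemidef.1

/-- The Haar mean over `1 ⊗ U^{⊗n}` of a pure state `(M ⊗ 1) |Γ⟩`. -/
lemma haarMean_localUnitary_ketbra (ψ : (Fin n → d) × (Fin n → d) → ℂ) :
    (haarMean fun U : Matrix.unitaryGroup d ℂ =>
      localUnitary n U * ketbra ψ * (localUnitary n U)ᴴ) =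
    (coeffMatrix ψ ⊗ₖ (1 : Matrix (Fin n → d) (Fin n → d) ℂ)) * R d n *
      (coeffMatrix ψ ⊗ₖ (1 : Matrix (Fin n → d) (Fin n → d) ℂ))ᴴ := by
  rw [R_eq_haarMean, ← haarMean_mul_mul (continuous_localUnitary_conj _)]
  congr 1
  ext1 U
  conv_lhs => rw [eq_kronecker_one_mulVec_gammaVec ψ, ← mul_ketbra_mul_conjTranspose]
  simp only [← mul_assoc]
  rw [← kronecker_one_mul_localUnitary, mul_assoc _ _ (localUnitary n U)ᴴ,
    ← Matrix.conjTranspose_mul, ← kronecker_one_mul_localUnitary, Matrix.conjTranspose_mul]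
  simp only [mul_assoc]

lemma localUnitary_mul_R (V : Matrix.unitaryGroup d ℂ) :
    localUnitary n V * R d n * (localUnitary n V)ᴴ = R d n := by
  conv_rhs => rw [R_eq_haarMean, ← haarMean_comp_mul_left _ V]
  rw [R_eq_haarMean, ← haarMean_mul_mul (continuous_localUnitary_conj _)]
  simp only [localUnitary_mul, Matrix.conjTranspose_mul, mul_assoc]

/-- The transpose trick: acting on `|Γ⟩`, a unitary `V^{⊗n}` on the first system equals `Vᵀ` to the
same power on the second, where right invariance of Haar measure absorbs it. -/
lemma tensorPow_kronecker_one_mul_R (V : Matrix.unitaryGroup d ℂ) :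
    (tensorPow n (V : Matrix d d ℂ) ⊗ₖ (1 : Matrix (Fin n → d) (Fin n → d) ℂ)) * R d n *
      (tensorPow n (V : Matrix d d ℂ) ⊗ₖ (1 : Matrix (Fin n → d) (Fin n → d) ℂ))ᴴ = R d n := by
  let V' : Matrix.unitaryGroup d ℂ := ⟨(V : Matrix d d ℂ)ᵀ, Matrix.transpose_mem_unitaryGroup_iff.mpr V.2⟩
  conv_rhs => rw [R_eq_haarMean, ← haarMean_comp_mul_right _ V']
  rw [R_eq_haarMean, ← haarMean_mul_mul (continuous_localUnitary_conj _)]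
  congr 1
  ext1 U
  rw [mul_ketbra_mul_conjTranspose, mul_ketbra_mul_conjTranspose, mul_ketbra_mul_conjTranspose]
  congr 1
  apply coeffMatrix_injective
  rw [coeffMatrix_kronecker_mulVec, coeffMatrix_localUnitary_mulVec,
    coeffMatrix_localUnitary_mulVec, coeffMatrix_gammaVec, one_mul, one_mul, Matrix.transpose_one,
    mul_one, transpose_tensorPow, transpose_tensorPow, ← tensorPow_mul]
  congr 1
  change _ = ((U : Matrix d d ℂ) * (V : Matrix d d ℂ)ᵀ)ᵀ
  rw [Matrix.transpose_mul, Matrix.transpose_transpose]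

/-- This holds already before averaging: the vector `(1 ⊗ U^{⊗n})|Γ⟩` has coefficient matrix
`(Uᵀ)^{⊗n}`, which is permutation symmetric. -/
lemma permMatrix_kronecker_mul_R (π : Equiv.Perm (Fin n)) :
    ((permMatrix π : Matrix (Fin n → d) (Fin n → d) ℂ) ⊗ₖ
      (permMatrix π : Matrix (Fin n → d) (Fin n → d) ℂ)) * R d n = R d n := by
  rw [R_eq_haarMean, ← haarMean_mul (continuous_localUnitary_conj _)]
  congr 1
  ext1 U
  rw [mul_ketbra_mul_conjTranspose, ketbra, Matrix.mul_vecMulVec]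
  congr 1
  apply coeffMatrix_injective
  rw [coeffMatrix_kronecker_mulVec, coeffMatrix_localUnitary_mulVec, coeffMatrix_gammaVec, one_mul,
    permMatrix_transpose, ← permMatrix_conjTranspose, transpose_tensorPow]
  exact isPermSymmetric_tensorPow (U : Matrix d d ℂ)ᵀ π

/-- Each averaged vector has a unitary coefficient matrix `C`, and its partial trace is `C Cᴴ = 1`.
-/
lemma traceSnd_R : traceSnd (R d n) = 1 := by
  rw [R_eq_haarMean]
  change traceSndLin _ = 1
  rw [← haarMean_linear (continuous_localUnitary_conj _), ← haarMean_const (d := d) 1]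
  congr 1
  ext1 U
  change traceSnd _ = 1
  rw [mul_ketbra_mul_conjTranspose, traceSnd_ketbra, coeffMatrix_localUnitary_mulVec,
    coeffMatrix_gammaVec, one_mul, transpose_tensorPow_unitary_mul_conjTranspose]

end ROperator

/-! ### Half of Schur–Weyl duality, and commutation with `R` -/

section Commutant

variable {d : Type*} [Fintype d] [DecidableEq d] {n : ℕ}

lemma infinite_unit_circle : {z : ℂ | star z * z = 1}.Infinite := by
  have : Set.SurjOn Complex.re {z : ℂ | star z * z = 1} (Set.Icc (-1) 1) := by
    intro x hx
    refine ⟨⟨x, Real.sqrt (1 - x ^ 2)⟩, ?_, rfl⟩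
    have h : Real.sqrt (1 - x ^ 2) * Real.sqrt (1 - x ^ 2) = 1 - x ^ 2 :=
      Real.mul_self_sqrt (by nlinarith [hx.1, hx.2])
    apply Complex.ext
    · simp [h]; ring
    · simp; ring
  intro hf
  exact Set.Icc_infinite (by norm_num : (-1 : ℝ) < 1) ((hf.image _).subset this)

/-- The permutation symmetric operators on `(ℂ^d)^{⊗n}` are spanned by the operators `U^{⊗n}`. -/
theorem mem_span_tensorPow_unitary {X : Matrix (Fin n → d) (Fin n → d) ℂ}
    (hX : IsPermSymmetric X) : X ∈ Submodule.span ℂ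
      (Set.range fun U : Matrix.unitaryGroup d ℂ => tensorPow n (U : Matrix d d ℂ)) := by
  refine Submodule.span_mono ?_ (mem_span_tensorPow infinite_unit_circle hX)
  rintro _ ⟨V, z, hz, rfl⟩
  have hd : Matrix.diagonal z ∈ Matrix.unitaryGroup d ℂ := by
    rw [Matrix.mem_unitaryGroup_iff', Matrix.star_eq_conjTranspose, Matrix.diagonal_conjTranspose,
      Matrix.diagonal_mul_diagonal, ← Matrix.diagonal_one]
    congr 1
    ext i
    exact hz i
  refine ⟨V * ⟨_, hd⟩ * star V, ?_⟩
  simp only [Submonoid.coe_mul, Unitary.coe_star, Matrix.star_eq_conjTranspose]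

/-- The permutation symmetric operators on `(ℂ^d)^{⊗n}` are spanned by the operators `ρ^{⊗n}` with
`ρ` positive semidefinite. -/
theorem mem_span_tensorPow_posSemidef {X : Matrix (Fin n → d) (Fin n → d) ℂ}
    (hX : IsPermSymmetric X) : X ∈ Submodule.span ℂ
      {Y | ∃ ρ : Matrix d d ℂ, ρ.PosSemidef ∧ tensorPow n ρ = Y} := by
  refine Submodule.span_mono ?_ (mem_span_tensorPow (s := {z | 0 ≤ z}) ?_ hX)
  · rintro _ ⟨V, z, hz, rfl⟩
    exact ⟨_, (Matrix.PosSemidef.diagonal hz).mul_mul_conjTranspose_same _, rfl⟩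
  · refine (Set.infinite_range_of_injective
      (Nat.cast_injective : Function.Injective ((↑) : ℕ → ℂ))).mono ?_
    rintro _ ⟨k, rfl⟩
    exact (Nat.cast_nonneg k : (0 : ℂ) ≤ (k : ℂ))

lemma commute_of_unitary_conj {a : Type*} [Fintype a] [DecidableEq a] {W X : Matrix a a ℂ}
    (hW : Wᴴ * W = 1) (h : W * X * Wᴴ = X) : Commute W X := by
  rw [commute_iff_eq]
  conv_rhs => rw [← h]
  rw [mul_assoc _ _ W, hW, mul_one]

/-- By linearity it is enough to treat `M = U^{⊗n}`, where it is the invariance of `R` under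
unitaries on the first system. -/
lemma commute_kronecker_one_R {M : Matrix (Fin n → d) (Fin n → d) ℂ} (hM : IsPermSymmetric M) :
    Commute (M ⊗ₖ (1 : Matrix (Fin n → d) (Fin n → d) ℂ)) (R d n) := by
  have hs := mem_span_tensorPow_unitary hM
  clear hM
  induction hs using Submodule.span_induction with
  | mem X hX =>
    obtain ⟨U, rfl⟩ := hX
    refine commute_of_unitary_conj ?_ (tensorPow_kronecker_one_mul_R U)
    rw [Matrix.conjTranspose_kronecker, ← Matrix.mul_kronecker_mul,
      conjTranspose_mul_tensorPow_unitary, Matrix.conjTranspose_one, one_mul,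
      Matrix.one_kronecker_one]
  | zero => simp
  | add X Y _ _ hX hY => rw [Matrix.add_kronecker]; exact hX.add_left hY
  | smul c X _ hX => rw [Matrix.smul_kronecker]; exact hX.smul_left c

lemma commute_one_kronecker_R {M : Matrix (Fin n → d) (Fin n → d) ℂ} (hM : IsPermSymmetric M) :
    Commute ((1 : Matrix (Fin n → d) (Fin n → d) ℂ) ⊗ₖ M) (R d n) := by
  have hs := mem_span_tensorPow_unitary hM
  clear hM
  induction hs using Submodule.span_induction with
  | mem X hX =>
    obtain ⟨U, rfl⟩ := hX
    exact commute_of_unitary_conj (localUnitary_conjTranspose_mul U) (localUnitary_mul_R U)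
  | zero => simp
  | add X Y _ _ hX hY => rw [Matrix.kronecker_add]; exact hX.add_left hY
  | smul c X _ hX => rw [Matrix.kronecker_smul]; exact hX.smul_left c

end Commutant

/-! ### Channel property and permutation invariance -/

section PurifyProperties

variable {d : Type*} [Fintype d] [DecidableEq d] {n : ℕ}

lemma purify_apply (X : Matrix (Fin n → d) (Fin n → d) ℂ) :
    purify d n X = CFC.sqrt (R d n) * (X ⊗ₖ (1 : Matrix (Fin n → d) (Fin n → d) ℂ)) *
      CFC.sqrt (R d n) := rfl

lemma isChannel_purify : IsChannel (purify d n) := by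
  refine ⟨isCompletelyPositive_kronecker_one _ (CFC.sqrt (R d n)) fun X => ?_, fun X => ?_⟩
  · rw [sqrt_isHermitian, purify_apply]
  · rw [purify_apply, mul_assoc, Matrix.trace_mul_comm, mul_assoc,
      sqrt_R_mul_self, trace_kronecker_one_mul, traceSnd_R, mul_one]

lemma permMatrix_kronecker_mul_sqrt_R (π : Equiv.Perm (Fin n)) :
    ((permMatrix π : Matrix (Fin n → d) (Fin n → d) ℂ) ⊗ₖ
      (permMatrix π : Matrix (Fin n → d) (Fin n → d) ℂ)) * CFC.sqrt (R d n) =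
      CFC.sqrt (R d n) :=
  mul_sqrt_eq_sqrt R_posSemidef (permMatrix_kronecker_mul_R π)

lemma purify_permMatrix_conj (π : Equiv.Perm (Fin n)) (X : Matrix (Fin n → d) (Fin n → d) ℂ) :
    purify d n (permMatrix π * X * (permMatrix π)ᴴ) = purify d n X := by
  set K := (permMatrix π : Matrix (Fin n → d) (Fin n → d) ℂ) ⊗ₖ
    (permMatrix π : Matrix (Fin n → d) (Fin n → d) ℂ) with hK
  have h1 : K * CFC.sqrt (R d n) = CFC.sqrt (R d n) := permMatrix_kronecker_mul_sqrt_R π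
  have h2 := congrArg Matrix.conjTranspose h1
  rw [Matrix.conjTranspose_mul, sqrt_isHermitian] at h2
  -- The root absorbs `K` on the right-hand factor and `Kᴴ` on the left-hand one, so the middle may
  -- be conjugated at will. This undoes `π` on `A` and leaves the identity on `B`.
  have h3 : ∀ Y, CFC.sqrt (R d n) * Y * CFC.sqrt (R d n) =
      CFC.sqrt (R d n) * (Kᴴ * Y * K) * CFC.sqrt (R d n) := by
    intro Y
    rw [mul_assoc _ _ (CFC.sqrt _), mul_assoc _ _ (CFC.sqrt _), mul_assoc _ K, h1,
      mul_assoc Kᴴ, ← mul_assoc _ Kᴴ, h2]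
  rw [purify_apply, purify_apply, h3, hK, Matrix.conjTranspose_kronecker,
    ← Matrix.mul_kronecker_mul, ← Matrix.mul_kronecker_mul, permMatrix_conjTranspose, mul_one,
    permMatrix_inv_mul]
  have h4 : permMatrix π⁻¹ * (permMatrix π * X * permMatrix π⁻¹) * permMatrix π = X := by
    rw [mul_assoc, mul_assoc _ _ (permMatrix π), permMatrix_inv_mul, mul_one, ← mul_assoc,
      permMatrix_inv_mul, one_mul]
  rw [h4]

end PurifyProperties

/-! ### Permutation symmetric purifications -/

section SymmetricPurifications

variable {d : Type*} [Fintype d] [DecidableEq d] {n : ℕ}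

lemma isSymmPurification_iff {ψ : (Fin n → d) × (Fin n → d) → ℂ}
    {ρ : Matrix (Fin n → d) (Fin n → d) ℂ} : IsSymmPurification ψ ρ ↔
      coeffMatrix ψ * (coeffMatrix ψ)ᴴ = ρ ∧ IsPermSymmetric (coeffMatrix ψ) := by
  rw [IsSymmPurification, IsPurification, traceSnd_ketbra]
  refine and_congr_right fun _ => forall_congr' fun π => ?_
  rw [← coeffMatrix_injective.eq_iff, coeffMatrix_kronecker_mulVec, permMatrix_transpose,
    permMatrix_conjTranspose]

lemma IsPermSymmetric.mul {X Y : Matrix (Fin n → d) (Fin n → d) ℂ} (hX : IsPermSymmetric X)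
    (hY : IsPermSymmetric Y) : IsPermSymmetric (X * Y) := by
  rw [isPermSymmetric_iff_commute] at *
  exact fun π => (hX π).mul_right (hY π)

/-- The coefficient matrix `√ρ` works, as it commutes with everything that commutes with `ρ`. -/
lemma exists_isSymmPurification {ρ : Matrix (Fin n → d) (Fin n → d) ℂ} (hρ : ρ.PosSemidef)
    (hs : IsPermSymmetric ρ) : ∃ ψ, IsSymmPurification ψ ρ := by
  refine ⟨fun x => CFC.sqrt ρ x.1 x.2, isSymmPurification_iff.mpr ⟨?_, ?_⟩⟩
  · change CFC.sqrt ρ * (CFC.sqrt ρ)ᴴ = ρ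
    rw [sqrt_isHermitian, CFC.sqrt_mul_sqrt_self _ hρ.nonneg]
  · exact isPermSymmetric_iff_commute.mpr fun π =>
      commute_sqrt (isPermSymmetric_iff_commute.mp hs π)

lemma IsSymmPurification.localUnitary_mulVec {ψ : (Fin n → d) × (Fin n → d) → ℂ}
    {ρ : Matrix (Fin n → d) (Fin n → d) ℂ} (hψ : IsSymmPurification ψ ρ)
    (U : Matrix.unitaryGroup d ℂ) : IsSymmPurification (localUnitary n U *ᵥ ψ) ρ := by
  rw [isSymmPurification_iff] at *
  rw [coeffMatrix_localUnitary_mulVec]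
  refine ⟨?_, hψ.2.mul (isPermSymmetric_tensorPow (U : Matrix d d ℂ)ᵀ)⟩
  rw [Matrix.conjTranspose_mul, mul_assoc, ← mul_assoc _ _ (coeffMatrix ψ)ᴴ,
    transpose_tensorPow_unitary_mul_conjTranspose, one_mul, hψ.1]

/-- With `C` the coefficient matrix, `C ⊗ 1` and its adjoint commute with `√R`, so `√R (C Cᴴ ⊗ 1) √R
= (C ⊗ 1) R (C ⊗ 1)ᴴ`, which is the Haar mean. -/
theorem purify_eq_haarMean {ψ : (Fin n → d) × (Fin n → d) → ℂ}
    {ρ : Matrix (Fin n → d) (Fin n → d) ℂ} (hψ : IsSymmPurification ψ ρ) :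
    purify d n ρ = haarMean fun U : Matrix.unitaryGroup d ℂ =>
      localUnitary n U * ketbra ψ * (localUnitary n U)ᴴ := by
  rw [isSymmPurification_iff] at hψ
  have hc := (commute_sqrt (commute_kronecker_one_R hψ.2)).eq
  have hc' := congrArg Matrix.conjTranspose hc
  rw [Matrix.conjTranspose_mul, Matrix.conjTranspose_mul, sqrt_isHermitian] at hc'
  have hk : ρ ⊗ₖ (1 : Matrix (Fin n → d) (Fin n → d) ℂ) =
      (coeffMatrix ψ ⊗ₖ (1 : Matrix (Fin n → d) (Fin n → d) ℂ)) *
        (coeffMatrix ψ ⊗ₖ (1 : Matrix (Fin n → d) (Fin n → d) ℂ))ᴴ := by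
    rw [Matrix.conjTranspose_kronecker, ← Matrix.mul_kronecker_mul, hψ.1,
      Matrix.conjTranspose_one, mul_one]
  rw [haarMean_localUnitary_ketbra, purify_apply, hk, ← mul_assoc, ← hc, mul_assoc, ← hc',
    mul_assoc, ← mul_assoc (CFC.sqrt _), sqrt_R_mul_self, mul_assoc]

end SymmetricPurifications

/-! ### Product inputs and uniqueness -/

section IID

variable {d : Type*} [Fintype d] [DecidableEq d] {n : ℕ}

lemma isSymmPurification_tensorPow {ρ : Matrix d d ℂ} {ψ : d × d → ℂ} (h : IsPurification ψ ρ) :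
    IsSymmPurification (fun x : (Fin n → d) × (Fin n → d) => ∏ k, ψ (x.1 k, x.2 k))
      (tensorPow n ρ) := by
  rw [IsPurification, traceSnd_ketbra] at h
  rw [isSymmPurification_iff]
  change tensorPow n (coeffMatrix ψ) * (tensorPow n (coeffMatrix ψ))ᴴ = _ ∧
    IsPermSymmetric (tensorPow n (coeffMatrix ψ))
  refine ⟨?_, isPermSymmetric_tensorPow _⟩
  rw [conjTranspose_tensorPow, ← tensorPow_mul, h]

theorem purifiesIID_purify : PurifiesIID n (purify d n) := by
  intro ρ ψ _ hψ
  rw [purify_eq_haarMean (isSymmPurification_tensorPow hψ)]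
  congr 1
  ext1 U
  rw [tensorPow_mul, tensorPow_mul, regroup_mul, regroup_mul, regroup_tensorPow_kronecker,
    regroup_tensorPow_kronecker, regroup_tensorPow_ketbra, tensorPow_one,
    localUnitary_conjTranspose, localUnitary]

lemma exists_isPurification {ρ : Matrix d d ℂ} (hρ : ρ.PosSemidef) :
    ∃ ψ : d × d → ℂ, IsPurification ψ ρ := by
  refine ⟨fun x => CFC.sqrt ρ x.1 x.2, ?_⟩
  rw [IsPurification, traceSnd_ketbra]
  change CFC.sqrt ρ * (CFC.sqrt ρ)ᴴ = ρ
  rw [sqrt_isHermitian, CFC.sqrt_mul_sqrt_self _ hρ.nonneg]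

/-- Invariance allows `X` to be replaced by its average over permutations, which is a combination of
operators `ρ^{⊗n}` with `ρ ≥ 0`. Up to scale these are powers of states. -/
theorem eq_of_purifiesIID (hn : 1 ≤ n) {Φ Ψ : Matrix (Fin n → d) (Fin n → d) ℂ →ₗ[ℂ]
      Matrix ((Fin n → d) × (Fin n → d)) ((Fin n → d) × (Fin n → d)) ℂ}
    (hΦ : PurifiesIID n Φ) (hΨ : PurifiesIID n Ψ)
    (hΦp : ∀ (π : Equiv.Perm (Fin n)) X, Φ (permMatrix π * X * (permMatrix π)ᴴ) = Φ X)
    (hΨp : ∀ (π : Equiv.Perm (Fin n)) X, Ψ (permMatrix π * X * (permMatrix π)ᴴ) = Ψ X) :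
    Φ = Ψ := by
  ext1 X
  rw [← map_permTwirl Φ hΦp, ← map_permTwirl Ψ hΨp]
  refine LinearMap.eqOn_span' ?_ (mem_span_tensorPow_posSemidef (isPermSymmetric_permTwirl X))
  rintro _ ⟨ρ, hρ, rfl⟩
  -- Trace 0 means `ρ = 0`, which cannot be normalised. Its power vanishes because `n ≥ 1`; the
  -- empty power would be 1.
  by_cases ht : ρ.trace = 0
  · have h0 : tensorPow n ρ = 0 := by
      rw [hρ.trace_eq_zero_iff.mp ht]
      ext i j
      simpa [tensorPow_apply] using (by omega : n ≠ 0)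
    rw [h0, map_zero, map_zero]
  · have hst : IsState ((ρ.trace)⁻¹ • ρ) :=
      ⟨hρ.smul (inv_nonneg.mpr hρ.trace_nonneg), by simp [ht]⟩
    obtain ⟨ψ, hψ⟩ := exists_isPurification hst.1
    have h1 : ρ = ρ.trace • (ρ.trace)⁻¹ • ρ := by rw [smul_smul, mul_inv_cancel₀ ht, one_smul]
    rw [h1, tensorPow_smul, map_smul, map_smul, hΦ _ ψ hst hψ, hΨ _ ψ hst hψ]

end IID

/-! ### Schur's lemma for matrix representations -/

section SchurLemma

variable {G : Type*} [Monoid G] {p p' q q' : ℕ} {f : G →* Matrix (Fin p) (Fin p) ℂ}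
  {g : G →* Matrix (Fin p') (Fin p') ℂ}

/-- The intertwining map given by a matrix. -/
noncomputable def intertwiner (A : Matrix (Fin p') (Fin p) ℂ) (hA : ∀ x, A * f x = g x * A) :
    Representation.IntertwiningMap (matRep f) (matRep g) where
  toLinearMap := Matrix.toLin' A
  isIntertwining' := fun x => by
    refine LinearMap.ext fun v => ?_
    change A *ᵥ (f x *ᵥ v) = g x *ᵥ (A *ᵥ v)
    rw [Matrix.mulVec_mulVec, hA, Matrix.mulVec_mulVec]

lemma eq_zero_of_intertwining (hf : (matRep f).IsIrreducible) (hg : (matRep g).IsIrreducible)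
    (hfg : IsEmpty (Representation.Equiv (matRep f) (matRep g))) {A : Matrix (Fin p') (Fin p) ℂ}
    (hA : ∀ x, A * f x = g x * A) : A = 0 := by
  -- Schur's lemma enters as an instance: there is at most one intertwining map between inequivalent
  -- irreducibles.
  have h := Subsingleton.elim (intertwiner A hA) 0
  have h2 := congrArg Representation.IntertwiningMap.toLinearMap h
  exact (Matrix.toLin' (R := ℂ)).map_eq_zero_iff.mp h2

lemma exists_eq_smul_one_of_intertwining (hf : (matRep f).IsIrreducible)
    {A : Matrix (Fin p) (Fin p) ℂ} (hA : ∀ x, A * f x = f x * A) : ∃ c : ℂ, A = c • 1 := by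
  obtain ⟨c, hc⟩ := (Representation.IsIrreducible.algebraMap_intertwiningMap_bijective_of_isAlgClosed
    (k := ℂ) (ρ := matRep f)).2 (intertwiner A hA)
  refine ⟨c, ?_⟩
  have h2 := congrArg Representation.IntertwiningMap.toLinearMap hc
  apply (Matrix.toLin' (R := ℂ)).injective
  refine h2.symm.trans ?_
  rw [map_smul, Matrix.toLin'_one]
  rfl

lemma dim_pos_of_isIrreducible (hf : (matRep f).IsIrreducible) : 0 < p := by
  rcases Nat.eq_zero_or_pos p with rfl | h
  · exfalso
    refine bot_ne_top (α := Subrepresentation (matRep f)) ?_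
    refine Subrepresentation.toSubmodule_injective ?_
    exact Subsingleton.elim _ _
  · exact h

/-- The slice `N (a, ·) (b, ·)` of a bipartite matrix. -/
def slice {α β γ δ : Type*} (N : Matrix (α × β) (γ × δ) ℂ) (a : α) (b : γ) : Matrix β δ ℂ :=
  Matrix.of fun i j => N (a, i) (b, j)

lemma slice_one_kronecker_mul {α β γ δ : Type*} [Fintype α] [Fintype β] [DecidableEq α]
    (M : Matrix β β ℂ) (N : Matrix (α × β) (γ × δ) ℂ) (a : α) (b : γ) :
    slice (((1 : Matrix α α ℂ) ⊗ₖ M) * N) a b = M * slice N a b := by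
  ext i j
  simp [slice, Matrix.mul_apply, Fintype.sum_prod_type, Matrix.kroneckerMap_apply, Matrix.one_apply]

lemma slice_mul_one_kronecker {α β γ δ : Type*} [Fintype γ] [Fintype δ] [DecidableEq γ]
    (M : Matrix δ δ ℂ) (N : Matrix (α × β) (γ × δ) ℂ) (a : α) (b : γ) :
    slice (N * ((1 : Matrix γ γ ℂ) ⊗ₖ M)) a b = slice N a b * M := by
  ext i j
  simp [slice, Matrix.mul_apply, Fintype.sum_prod_type, Matrix.kroneckerMap_apply, Matrix.one_apply]

lemma eq_zero_of_one_kronecker_intertwining (hf : (matRep f).IsIrreducible)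
    (hg : (matRep g).IsIrreducible) (hfg : IsEmpty (Representation.Equiv (matRep f) (matRep g)))
    {N : Matrix (Fin q' × Fin p') (Fin q × Fin p) ℂ}
    (hN : ∀ x, N * ((1 : Matrix (Fin q) (Fin q) ℂ) ⊗ₖ f x) =
      ((1 : Matrix (Fin q') (Fin q') ℂ) ⊗ₖ g x) * N) : N = 0 := by
  have h : ∀ a b, slice N a b = 0 := fun a b => eq_zero_of_intertwining hf hg hfg fun x => by
    rw [← slice_mul_one_kronecker, hN, slice_one_kronecker_mul]
  ext x y
  exact congrFun (congrFun (h x.1 y.1) x.2) y.2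

/-- Each slice at fixed multiplicity indices is an intertwiner of `f` with itself, hence a scalar;
these scalars are the entries of `z`. -/
lemma eq_kronecker_one_of_one_kronecker_intertwining (hf : (matRep f).IsIrreducible)
    {N : Matrix (Fin q' × Fin p) (Fin q × Fin p) ℂ}
    (hN : ∀ x, N * ((1 : Matrix (Fin q) (Fin q) ℂ) ⊗ₖ f x) =
      ((1 : Matrix (Fin q') (Fin q') ℂ) ⊗ₖ f x) * N) :
    ∃ z : Matrix (Fin q') (Fin q) ℂ, N = z ⊗ₖ (1 : Matrix (Fin p) (Fin p) ℂ) := by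
  have h : ∀ a b, ∃ c : ℂ, slice N a b = c • 1 := fun a b =>
    exists_eq_smul_one_of_intertwining hf fun x => by
      rw [← slice_mul_one_kronecker, hN, slice_one_kronecker_mul]
  choose z hz using h
  refine ⟨Matrix.of z, ?_⟩
  ext x y
  exact congrFun (congrFun (hz x.1 y.1) x.2) y.2

end SchurLemma

/-! ### Block rows of a block-diagonalising unitary -/

section BlockRows

variable {L : Type*} [Fintype L] [DecidableEq L] {κ : L → Type*} [∀ l, Fintype (κ l)]
  [∀ l, DecidableEq (κ l)] {ι : Type*} [Fintype ι] [DecidableEq ι] {W : Matrix (Σ l, κ l) ι ℂ}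

/-- The `l`-th block row. -/
def rowBlock (W : Matrix (Σ l, κ l) ι ℂ) (l : L) : Matrix (κ l) ι ℂ :=
  W.submatrix (fun x => ⟨l, x⟩) id

lemma rowBlock_mul_mul_conjTranspose_apply (X : Matrix ι ι ℂ) (l l' : L) (x : κ l) (y : κ l') :
    (rowBlock W l * X * (rowBlock W l')ᴴ) x y = (W * X * Wᴴ) ⟨l, x⟩ ⟨l', y⟩ := rfl

lemma rowBlock_mul_conjTranspose_self (hW : W * Wᴴ = 1) (l : L) :
    rowBlock W l * (rowBlock W l)ᴴ = 1 := by
  ext x y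
  refine (congrFun (congrFun hW ⟨l, x⟩) ⟨l, y⟩).trans ?_
  simp [Matrix.one_apply]

lemma rowBlock_mul_conjTranspose_of_ne (hW : W * Wᴴ = 1) {l l' : L} (h : l ≠ l') :
    rowBlock W l * (rowBlock W l')ᴴ = 0 := by
  ext x y
  refine (congrFun (congrFun hW ⟨l, x⟩) ⟨l', y⟩).trans ?_
  simp [h]

lemma sum_conjTranspose_mul_rowBlock (hW : Wᴴ * W = 1) :
    ∑ l, (rowBlock W l)ᴴ * rowBlock W l = 1 := by
  rw [← hW]
  ext i j
  simp only [Matrix.sum_apply, Matrix.mul_apply, Fintype.sum_sigma]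
  rfl

lemma rowBlock_mul_eq (hW : Wᴴ * W = 1) {X : Matrix ι ι ℂ} {D : ∀ l, Matrix (κ l) (κ l) ℂ}
    (h : W * X * Wᴴ = Matrix.blockDiagonal' D) (l : L) :
    rowBlock W l * X = D l * rowBlock W l := by
  have h2 : W * X = Matrix.blockDiagonal' D * W := by
    rw [← h, Matrix.mul_assoc, hW, Matrix.mul_one]
  ext x j
  refine (congrFun (congrFun h2 ⟨l, x⟩) j).trans ?_
  rw [Matrix.mul_apply, Fintype.sum_sigma, Finset.sum_eq_single l, Matrix.mul_apply]
  · simp [Matrix.blockDiagonal'_apply_eq, rowBlock]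
  · intro l' _ hl'
    exact Finset.sum_eq_zero fun y _ => by
      rw [Matrix.blockDiagonal'_apply_ne _ _ _ hl'.symm, zero_mul]
  · simp

lemma mul_conjTranspose_rowBlock_eq (hW : Wᴴ * W = 1) {X : Matrix ι ι ℂ}
    {D : ∀ l, Matrix (κ l) (κ l) ℂ} (h : W * X * Wᴴ = Matrix.blockDiagonal' D) (l : L) :
    X * (rowBlock W l)ᴴ = (rowBlock W l)ᴴ * D l := by
  have h2 : W * Xᴴ * Wᴴ = Matrix.blockDiagonal' fun l => (D l)ᴴ := by
    rw [← Matrix.blockDiagonal'_conjTranspose, ← h]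
    simp [Matrix.conjTranspose_mul, Matrix.mul_assoc]
  have h3 := congrArg Matrix.conjTranspose (rowBlock_mul_eq hW h2 l)
  simpa [Matrix.conjTranspose_mul] using h3

end BlockRows

/-! ### Inserting a maximally entangled vector -/

section EntangledEmbedding

/-- The operator `ℂ^q ⊗ ℂ^q → (ℂ^q ⊗ ℂ^p) ⊗ (ℂ^q ⊗ ℂ^p)` inserting the vector `|Γ⟩` of
`ℂ^p ⊗ ℂ^p`. -/
def insertGamma (q p : ℕ) : Matrix ((Fin q × Fin p) × (Fin q × Fin p)) (Fin q × Fin q) ℂ :=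
  Matrix.of fun x y => if x.1.1 = y.1 ∧ x.2.1 = y.2 ∧ x.1.2 = x.2.2 then 1 else 0

variable {q p : ℕ}

lemma insertGamma_mulVec (v : Fin q × Fin q → ℂ) :
    coeffMatrix (insertGamma q p *ᵥ v) = coeffMatrix v ⊗ₖ (1 : Matrix (Fin p) (Fin p) ℂ) := by
  ext ⟨a, i⟩ ⟨b, j⟩
  simp [coeffMatrix, insertGamma, Matrix.mulVec, dotProduct, Fintype.sum_prod_type, ite_and,
    Matrix.kroneckerMap_apply, Matrix.one_apply]

/-- Contracting both `ℂ^p` registers with `|Γ⟩` identifies their indices, which is a partial trace.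
This is how discarding the register `P_l` emerges from the formula for `Λ`. -/
lemma insertGamma_conj (Y : Matrix (Fin q × Fin p) (Fin q × Fin p) ℂ) :
    (insertGamma q p)ᴴ * (Y ⊗ₖ (1 : Matrix (Fin q × Fin p) (Fin q × Fin p) ℂ)) *
      insertGamma q p = traceSnd Y ⊗ₖ (1 : Matrix (Fin q) (Fin q) ℂ) := by
  ext ⟨a, b⟩ ⟨a', b'⟩
  simp [insertGamma, Matrix.mul_apply, Fintype.sum_prod_type, ite_and, apply_ite star,
    Matrix.kroneckerMap_apply, Matrix.one_apply, traceSnd, eq_comm]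

lemma conjTranspose_mul_insertGamma :
    (insertGamma q p)ᴴ * insertGamma q p = (p : ℂ) • 1 := by
  have h := insertGamma_conj (q := q) (p := p) 1
  rw [Matrix.one_kronecker_one, Matrix.mul_one] at h
  rw [h, ← Matrix.one_kronecker_one (m := Fin q) (n := Fin q), ← Matrix.smul_kronecker]
  congr 1
  ext a b
  simp [traceSnd, Matrix.one_apply, Prod.ext_iff]

lemma kronecker_mul_insertGamma (m m' : Matrix (Fin q) (Fin q) ℂ) :
    ((m ⊗ₖ (1 : Matrix (Fin p) (Fin p) ℂ)) ⊗ₖ (m' ⊗ₖ (1 : Matrix (Fin p) (Fin p) ℂ))) *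
      insertGamma q p = insertGamma q p * (m ⊗ₖ m') := by
  ext ⟨⟨a, i⟩, b, j⟩ ⟨a', b'⟩
  simp [insertGamma, Matrix.mul_apply, Fintype.sum_prod_type, ite_and,
    Matrix.kroneckerMap_apply, Matrix.one_apply]

/-- The factor `q⁻¹` comes from the maximally mixed state and `p⁻¹` from normalising `|Γ⟩⟨Γ|`. -/
lemma prepare_eq (Z : Matrix (Fin q) (Fin q) ℂ) :
    prepare q p Z = ((q : ℂ)⁻¹ * (p : ℂ)⁻¹) •
      (insertGamma q p * (Z ⊗ₖ (1 : Matrix (Fin q) (Fin q) ℂ)) * (insertGamma q p)ᴴ) := by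
  ext ⟨⟨a, i⟩, b, j⟩ ⟨⟨a', i'⟩, b', j'⟩
  simp [insertGamma, Matrix.mul_apply, Fintype.sum_prod_type, ite_and, apply_ite star, prepare,
    maxMixed, maxEntangled, ketbra, gammaVec, Matrix.vecMulVec_apply,
    Matrix.kroneckerMap_apply, Matrix.one_apply]
  split_ifs <;> first | rfl | ring

end EntangledEmbedding

/-! ### Dual Schur transforms diagonalise `R` -/

section DualPair

variable {d : Type*} [Fintype d] [DecidableEq d] {n : ℕ}
  {L : Type} [Fintype L] [DecidableEq L] {q p : L → ℕ}

/-- On the block, permutations act as `1 ⊗ f l π`, which commutes with `m ⊗ 1`. These are the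
symmetric operators on which commutation with `R` is tested. -/
lemma isPermSymmetric_rowBlock_conj {W : Matrix (Σ l, Fin (q l) × Fin (p l)) (Fin n → d) ℂ}
    {f : ∀ l, Equiv.Perm (Fin n) →* Matrix (Fin (p l)) (Fin (p l)) ℂ} (hW : Wᴴ * W = 1)
    (hWf : ∀ π : Equiv.Perm (Fin n), W * (permMatrix π : Matrix (Fin n → d) (Fin n → d) ℂ) * Wᴴ =
      Matrix.blockDiagonal' fun l => (1 : Matrix (Fin (q l)) (Fin (q l)) ℂ) ⊗ₖ f l π)
    (l : L) (m : Matrix (Fin (q l)) (Fin (q l)) ℂ) :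
    IsPermSymmetric ((rowBlock W l)ᴴ * (m ⊗ₖ (1 : Matrix (Fin (p l)) (Fin (p l)) ℂ)) *
      rowBlock W l) := by
  rw [isPermSymmetric_iff_commute]
  intro π
  have h : (m ⊗ₖ (1 : Matrix (Fin (p l)) (Fin (p l)) ℂ)) *
        ((1 : Matrix (Fin (q l)) (Fin (q l)) ℂ) ⊗ₖ f l π) =
      ((1 : Matrix (Fin (q l)) (Fin (q l)) ℂ) ⊗ₖ f l π) *
        (m ⊗ₖ (1 : Matrix (Fin (p l)) (Fin (p l)) ℂ)) := by
    rw [← Matrix.mul_kronecker_mul, ← Matrix.mul_kronecker_mul, one_mul, mul_one, mul_one, one_mul]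
  rw [commute_iff_eq, Matrix.mul_assoc _ _ (permMatrix π), rowBlock_mul_eq hW (hWf π),
    ← Matrix.mul_assoc, ← Matrix.mul_assoc, mul_conjTranspose_rowBlock_eq hW (hWf π),
    ← Matrix.mul_assoc, Matrix.mul_assoc (rowBlock W l)ᴴ (_ ⊗ₖ _) (_ ⊗ₖ _), ← h,
    ← Matrix.mul_assoc]

namespace SchurTransform

variable (S T : SchurTransform d n L q p)

lemma block_mul_self (l : L) : S.block l * (S.block l)ᴴ = 1 :=
  rowBlock_mul_conjTranspose_self S.W_mul_conjTranspose l

lemma block_mul_of_ne {l l' : L} (h : l ≠ l') : S.block l * (S.block l')ᴴ = 0 :=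
  rowBlock_mul_conjTranspose_of_ne S.W_mul_conjTranspose h

lemma sum_block : ∑ l, (S.block l)ᴴ * S.block l = 1 :=
  sum_conjTranspose_mul_rowBlock S.conjTranspose_mul_W

lemma block_mul_permMatrix (l : L) (π : Equiv.Perm (Fin n)) :
    S.block l * (permMatrix π : Matrix (Fin n → d) (Fin n → d) ℂ) =
      ((1 : Matrix (Fin (q l)) (Fin (q l)) ℂ) ⊗ₖ S.permRep l π) * S.block l :=
  rowBlock_mul_eq S.conjTranspose_mul_W (S.W_perm π) l

lemma permMatrix_mul_block (l : L) (π : Equiv.Perm (Fin n)) :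
    (permMatrix π : Matrix (Fin n → d) (Fin n → d) ℂ) * (S.block l)ᴴ =
      (S.block l)ᴴ * ((1 : Matrix (Fin (q l)) (Fin (q l)) ℂ) ⊗ₖ S.permRep l π) :=
  mul_conjTranspose_rowBlock_eq S.conjTranspose_mul_W (S.W_perm π) l

lemma q_pos (S : SchurTransform d n L q p) (l : L) : 0 < q l := dim_pos_of_isIrreducible (S.unitaryRep_irreducible l)

lemma p_pos (S : SchurTransform d n L q p) (l : L) : 0 < p l := dim_pos_of_isIrreducible (S.permRep_irreducible l)

/-- The operator `m ⊗ 1` on the `l`-th block. -/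
noncomputable def blockOperator (l : L) (m : Matrix (Fin (q l)) (Fin (q l)) ℂ) :
    Matrix (Fin n → d) (Fin n → d) ℂ :=
  (S.block l)ᴴ * (m ⊗ₖ (1 : Matrix (Fin (p l)) (Fin (p l)) ℂ)) * S.block l

lemma isPermSymmetric_blockOperator (l : L) (m : Matrix (Fin (q l)) (Fin (q l)) ℂ) :
    IsPermSymmetric (S.blockOperator l m) :=
  isPermSymmetric_rowBlock_conj S.conjTranspose_mul_W S.W_perm l m

/-- The operator `(S_l ⊗ T_l)† (1 ⊗ 1 ⊗ |Γ⟩)`. -/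
noncomputable def entangler (l : L) :
    Matrix ((Fin n → d) × (Fin n → d)) (Fin (q l) × Fin (q l)) ℂ :=
  (S.block l ⊗ₖ T.block l)ᴴ * insertGamma (q l) (p l)

lemma conjTranspose_entangler_mul_kronecker (X : Matrix (Fin n → d) (Fin n → d) ℂ) (l : L) :
    (S.entangler T l)ᴴ * (X ⊗ₖ (1 : Matrix (Fin n → d) (Fin n → d) ℂ)) * S.entangler T l =
      traceSnd (S.block l * X * (S.block l)ᴴ) ⊗ₖ (1 : Matrix (Fin (q l)) (Fin (q l)) ℂ) := by
  rw [← insertGamma_conj, entangler, Matrix.conjTranspose_mul, Matrix.conjTranspose_conjTranspose,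
    ← T.block_mul_self l, Matrix.mul_kronecker_mul, ← Matrix.mul_one (T.block l),
    Matrix.mul_kronecker_mul, Matrix.mul_one, Matrix.conjTranspose_kronecker]
  simp only [Matrix.mul_assoc]

lemma conjTranspose_entangler_mul_kronecker_of_ne (X : Matrix (Fin n → d) (Fin n → d) ℂ)
    {l l' : L} (h : l ≠ l') :
    (S.entangler T l)ᴴ * (X ⊗ₖ (1 : Matrix (Fin n → d) (Fin n → d) ℂ)) * S.entangler T l' = 0 := by
  have h0 : (S.block l ⊗ₖ T.block l) * (X ⊗ₖ (1 : Matrix (Fin n → d) (Fin n → d) ℂ)) *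
      (S.block l' ⊗ₖ T.block l')ᴴ = 0 := by
    rw [Matrix.conjTranspose_kronecker, ← Matrix.mul_kronecker_mul, ← Matrix.mul_kronecker_mul,
      Matrix.mul_one, T.block_mul_of_ne h, Matrix.kronecker_zero]
  rw [entangler, entangler, Matrix.conjTranspose_mul, Matrix.conjTranspose_conjTranspose,
    ← Matrix.mul_assoc, Matrix.mul_assoc _ (S.block l ⊗ₖ T.block l), Matrix.mul_assoc _ _ (_ᴴ), h0,
    Matrix.mul_zero, Matrix.zero_mul]

/-- The factor is `⟨Γ|Γ⟩ = p l`: the entangler is an isometry up to `√(p l)`. -/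
lemma conjTranspose_entangler_mul_self (l : L) :
    (S.entangler T l)ᴴ * S.entangler T l = (p l : ℂ) • 1 := by
  have h := conjTranspose_entangler_mul_kronecker S T 1 l
  rw [Matrix.one_kronecker_one, Matrix.mul_one, Matrix.mul_one, S.block_mul_self] at h
  have h2 := insertGamma_conj (q := q l) (p := p l) 1
  rw [Matrix.one_kronecker_one, Matrix.mul_one, conjTranspose_mul_insertGamma] at h2
  rw [h, h2]

lemma conjTranspose_entangler_mul_of_ne {l l' : L} (h : l ≠ l') :
    (S.entangler T l)ᴴ * S.entangler T l' = 0 := by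
  have h := conjTranspose_entangler_mul_kronecker_of_ne S T 1 h
  rwa [Matrix.one_kronecker_one, Matrix.mul_one] at h

lemma blockOperator_mul_conjTranspose (l : L) (m : Matrix (Fin (q l)) (Fin (q l)) ℂ) :
    S.blockOperator l m * (S.block l)ᴴ =
      (S.block l)ᴴ * (m ⊗ₖ (1 : Matrix (Fin (p l)) (Fin (p l)) ℂ)) := by
  rw [blockOperator, Matrix.mul_assoc, S.block_mul_self, Matrix.mul_one]

lemma blockOperator_kronecker_mul_entangler (l : L) (m : Matrix (Fin (q l)) (Fin (q l)) ℂ) :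
    (S.blockOperator l m ⊗ₖ (1 : Matrix (Fin n → d) (Fin n → d) ℂ)) * S.entangler T l =
      S.entangler T l * (m ⊗ₖ (1 : Matrix (Fin (q l)) (Fin (q l)) ℂ)) := by
  rw [entangler, Matrix.mul_assoc, ← kronecker_mul_insertGamma, ← Matrix.mul_assoc,
    ← Matrix.mul_assoc, Matrix.conjTranspose_kronecker, ← Matrix.mul_kronecker_mul,
    ← Matrix.mul_kronecker_mul, blockOperator_mul_conjTranspose, Matrix.one_mul,
    Matrix.one_kronecker_one, Matrix.mul_one]

lemma kronecker_blockOperator_mul_entangler (l : L) (m : Matrix (Fin (q l)) (Fin (q l)) ℂ) :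
    ((1 : Matrix (Fin n → d) (Fin n → d) ℂ) ⊗ₖ T.blockOperator l m) * S.entangler T l =
      S.entangler T l * ((1 : Matrix (Fin (q l)) (Fin (q l)) ℂ) ⊗ₖ m) := by
  rw [entangler, Matrix.mul_assoc, ← kronecker_mul_insertGamma, ← Matrix.mul_assoc,
    ← Matrix.mul_assoc, Matrix.conjTranspose_kronecker, ← Matrix.mul_kronecker_mul,
    ← Matrix.mul_kronecker_mul, blockOperator_mul_conjTranspose, Matrix.one_mul,
    Matrix.one_kronecker_one, Matrix.mul_one]

lemma blockOperator_kronecker_mul_entangler_of_ne {l l' : L} (h : l ≠ l')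
    (m : Matrix (Fin (q l)) (Fin (q l)) ℂ) :
    (S.blockOperator l m ⊗ₖ (1 : Matrix (Fin n → d) (Fin n → d) ℂ)) * S.entangler T l' = 0 := by
  rw [entangler, ← Matrix.mul_assoc, Matrix.conjTranspose_kronecker, ← Matrix.mul_kronecker_mul,
    blockOperator, Matrix.mul_assoc, S.block_mul_of_ne h, Matrix.mul_zero, Matrix.zero_kronecker,
    Matrix.zero_mul]

lemma conjTranspose_blockOperator (l : L) (m : Matrix (Fin (q l)) (Fin (q l)) ℂ) :
    (S.blockOperator l m)ᴴ = S.blockOperator l mᴴ := by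
  simp [blockOperator, Matrix.conjTranspose_mul, Matrix.conjTranspose_kronecker, Matrix.mul_assoc]

variable {S T}

/-- A vector of the symmetric subspace is a sum of vectors `(S_l ⊗ T_l)† (v_l ⊗ |Γ⟩)`. -/
lemma IsDual.eq_sum_entangler_mulVec (hST : S.IsDual T)
    {ψ : (Fin n → d) × (Fin n → d) → ℂ} (hψ : IsPermSymmetric (coeffMatrix ψ)) :
    ∃ v : ∀ l, Fin (q l) × Fin (q l) → ℂ, ψ = ∑ l, S.entangler T l *ᵥ v l := by
  -- Duality enters here. Conjugating the relation for `T` entrywise, with `P_π` real, turns its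
  -- matrices into those of `S`, so that Schur's lemma can be applied within the one family
  -- `S.permRep`.
  have hT : ∀ l π, (permMatrix π : Matrix (Fin n → d) (Fin n → d) ℂ) * (T.block l)ᵀ =
      (T.block l)ᵀ * ((1 : Matrix (Fin (q l)) (Fin (q l)) ℂ) ⊗ₖ S.permRep l π) := by
    intro l π
    have h := congrArg (Matrix.map · (starRingEnd ℂ)) (T.permMatrix_mul_block l π)
    simp only [Matrix.map_mul] at h
    rw [hST l π] at h
    have h1 : ((T.block l)ᴴ).map (starRingEnd ℂ) = (T.block l)ᵀ := by
      ext
      simp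
    have h2 : ((1 : Matrix (Fin (q l)) (Fin (q l)) ℂ) ⊗ₖ (S.permRep l π).map star).map
        (starRingEnd ℂ) = (1 : Matrix (Fin (q l)) (Fin (q l)) ℂ) ⊗ₖ S.permRep l π := by
      ext
      simp [Matrix.kroneckerMap_apply, Matrix.one_apply, apply_ite (starRingEnd ℂ)]
    have h3 : (permMatrix (m := d) π).map (starRingEnd ℂ) = permMatrix π := permMatrix_map_star π
    rwa [h1, h2, h3] at h
  have hint : ∀ l l' π, (S.block l * coeffMatrix ψ * (T.block l')ᵀ) *
        ((1 : Matrix (Fin (q l')) (Fin (q l')) ℂ) ⊗ₖ S.permRep l' π) =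
      ((1 : Matrix (Fin (q l)) (Fin (q l)) ℂ) ⊗ₖ S.permRep l π) *
        (S.block l * coeffMatrix ψ * (T.block l')ᵀ) := by
    intro l l' π
    rw [Matrix.mul_assoc, ← hT, ← Matrix.mul_assoc, ← Matrix.mul_assoc, ← Matrix.mul_assoc,
      ← S.block_mul_permMatrix, Matrix.mul_assoc (S.block l) _ (permMatrix π),
      Matrix.mul_assoc (S.block l) (permMatrix π), (isPermSymmetric_iff_commute.mp hψ π).eq]
  have hne : ∀ l l', l ≠ l' → S.block l * coeffMatrix ψ * (T.block l')ᵀ = 0 := fun l l' h =>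
    eq_zero_of_one_kronecker_intertwining (S.permRep_irreducible l') (S.permRep_irreducible l)
      (S.permRep_inequivalent l' l h.symm) (hint l l')
  choose z hz using fun l =>
    eq_kronecker_one_of_one_kronecker_intertwining (S.permRep_irreducible l) (hint l l)
  refine ⟨fun l x => z l x.1 x.2, coeffMatrix_injective ?_⟩
  have hsum : coeffMatrix (∑ l, S.entangler T l *ᵥ fun x => z l x.1 x.2) =
      ∑ l, coeffMatrix (S.entangler T l *ᵥ fun x => z l x.1 x.2) := by
    ext i j
    simp [coeffMatrix, Matrix.sum_apply]
  have hterm : ∀ l, coeffMatrix (S.entangler T l *ᵥ fun x => z l x.1 x.2) =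
      (S.block l)ᴴ * (S.block l * coeffMatrix ψ * (T.block l)ᵀ) * ((T.block l)ᴴ)ᵀ := by
    intro l
    rw [entangler, ← Matrix.mulVec_mulVec, Matrix.conjTranspose_kronecker,
      coeffMatrix_kronecker_mulVec, insertGamma_mulVec, hz]
    rfl
  have hTsum : ∑ l, (T.block l)ᵀ * ((T.block l)ᴴ)ᵀ = 1 := by
    rw [← Matrix.transpose_one, ← T.sum_block, Matrix.transpose_sum]
    exact Finset.sum_congr rfl fun l _ => (Matrix.transpose_mul _ _).symm
  rw [hsum, Finset.sum_congr rfl fun l _ => hterm l]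
  -- Resolutions of the identity on both sides split the matrix into blocks; by Schur's lemma only
  -- the diagonal ones, of the form `z ⊗ 1`, survive.
  calc coeffMatrix ψ = (∑ l, (S.block l)ᴴ * S.block l) * coeffMatrix ψ *
        ∑ l, (T.block l)ᵀ * ((T.block l)ᴴ)ᵀ := by
          rw [S.sum_block, hTsum, Matrix.one_mul, Matrix.mul_one]
    _ = ∑ l, ∑ l', (S.block l)ᴴ * (S.block l * coeffMatrix ψ * (T.block l')ᵀ) *
          ((T.block l')ᴴ)ᵀ := by
          rw [Finset.sum_mul, Finset.sum_mul]
          refine Finset.sum_congr rfl fun l _ => ?_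
          rw [Finset.mul_sum]
          refine Finset.sum_congr rfl fun l' _ => ?_
          simp only [Matrix.mul_assoc]
    _ = _ := by
          refine Finset.sum_congr rfl fun l _ => ?_
          rw [Finset.sum_eq_single l]
          · intro l' _ h
            rw [hne l l' h.symm, Matrix.mul_zero, Matrix.zero_mul]
          · simp


lemma sum_entangler_mul_conjTranspose_mul_entangler (c : L → ℂ) (l : L) :
    (∑ l', c l' • (S.entangler T l' * (S.entangler T l')ᴴ)) * S.entangler T l =
      (c l * p l) • S.entangler T l := by
  rw [Matrix.sum_mul, Finset.sum_eq_single l]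
  · rw [Matrix.smul_mul, Matrix.mul_assoc, conjTranspose_entangler_mul_self, Matrix.mul_smul,
      Matrix.mul_one, smul_smul]
  · intro l' _ h
    rw [Matrix.smul_mul, Matrix.mul_assoc, conjTranspose_entangler_mul_of_ne S T h,
      Matrix.mul_zero, smul_zero]
  · simp

/-- The projection onto the symmetric subspace acts trivially on `R`. -/
lemma IsDual.symmProjection_mul_R (hST : S.IsDual T) :
    (∑ l, (p l : ℂ)⁻¹ • (S.entangler T l * (S.entangler T l)ᴴ)) * R d n = R d n := by
  -- Column by column: each column of `R` is a symmetric vector, hence a sum of vectors in the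
  -- ranges of the entanglers.
  refine Matrix.ext_of_mulVec_single fun x => ?_
  rw [← Matrix.mulVec_mulVec]
  set ψ := R d n *ᵥ Pi.single x 1 with hψ
  have hs : IsPermSymmetric (coeffMatrix ψ) := by
    intro π
    rw [permMatrix_conjTranspose, ← permMatrix_transpose, ← coeffMatrix_kronecker_mulVec, hψ,
      Matrix.mulVec_mulVec, permMatrix_kronecker_mul_R]
  obtain ⟨v, hv⟩ := hST.eq_sum_entangler_mulVec hs
  rw [hv, Matrix.mulVec_sum]
  refine Finset.sum_congr rfl fun l _ => ?_
  rw [Matrix.mulVec_mulVec, sum_entangler_mul_conjTranspose_mul_entangler, inv_mul_cancel₀,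
    one_smul]
  exact_mod_cast (S.p_pos l).ne'

/-- The projection of `A^{⊗n}` onto block `l` commutes with `R`, fixes the range of the `l`-th
entangler and kills that of the `l'`-th. -/
lemma conjTranspose_entangler_mul_R_of_ne {l l' : L} (h : l ≠ l') :
    (S.entangler T l)ᴴ * R d n * S.entangler T l' = 0 := by
  have h1 := congrArg Matrix.conjTranspose (S.blockOperator_kronecker_mul_entangler T l 1)
  rw [Matrix.one_kronecker_one, Matrix.mul_one, Matrix.conjTranspose_mul,
    Matrix.conjTranspose_kronecker, conjTranspose_blockOperator, Matrix.conjTranspose_one,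
    Matrix.conjTranspose_one] at h1
  rw [← h1, Matrix.mul_assoc _ _ (R d n),
    (commute_kronecker_one_R (S.isPermSymmetric_blockOperator l 1)).eq, Matrix.mul_assoc,
    Matrix.mul_assoc, blockOperator_kronecker_mul_entangler_of_ne S T h, Matrix.mul_zero,
    Matrix.mul_zero]

lemma exists_conjTranspose_entangler_mul_R (l : L) :
    ∃ r : ℂ, (S.entangler T l)ᴴ * R d n * S.entangler T l = r • 1 := by
  set Z := (S.entangler T l)ᴴ * R d n * S.entangler T l with hZ
  -- An operator `M` that commutes with `R` and acts on the range of the entangler as `m`, together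
  -- with its adjoint, makes `m` commute with `Z`.
  have key : ∀ (M : Matrix ((Fin n → d) × (Fin n → d)) ((Fin n → d) × (Fin n → d)) ℂ)
      (m : Matrix (Fin (q l) × Fin (q l)) (Fin (q l) × Fin (q l)) ℂ), Commute M (R d n) →
      M * S.entangler T l = S.entangler T l * m →
      Mᴴ * S.entangler T l = S.entangler T l * mᴴ → m * Z = Z * m := by
    intro M m hc h1 h2
    have h3 := congrArg Matrix.conjTranspose h2
    simp only [Matrix.conjTranspose_mul, Matrix.conjTranspose_conjTranspose] at h3
    rw [hZ, ← Matrix.mul_assoc, ← Matrix.mul_assoc, ← h3, Matrix.mul_assoc _ _ m, ← h1,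
      Matrix.mul_assoc _ M, hc.eq]
    simp only [Matrix.mul_assoc]
  have hA : ∀ m : Matrix (Fin (q l)) (Fin (q l)) ℂ,
      (m ⊗ₖ (1 : Matrix (Fin (q l)) (Fin (q l)) ℂ)) * Z =
        Z * (m ⊗ₖ (1 : Matrix (Fin (q l)) (Fin (q l)) ℂ)) := by
    intro m
    refine key _ _ (commute_kronecker_one_R (S.isPermSymmetric_blockOperator l m))
      (S.blockOperator_kronecker_mul_entangler T l m) ?_
    rw [Matrix.conjTranspose_kronecker, Matrix.conjTranspose_kronecker, conjTranspose_blockOperator,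
      Matrix.conjTranspose_one, Matrix.conjTranspose_one, blockOperator_kronecker_mul_entangler]
  have hB : ∀ m : Matrix (Fin (q l)) (Fin (q l)) ℂ,
      ((1 : Matrix (Fin (q l)) (Fin (q l)) ℂ) ⊗ₖ m) * Z =
        Z * ((1 : Matrix (Fin (q l)) (Fin (q l)) ℂ) ⊗ₖ m) := by
    intro m
    refine key _ _ (commute_one_kronecker_R (T.isPermSymmetric_blockOperator l m))
      (S.kronecker_blockOperator_mul_entangler T l m) ?_
    rw [Matrix.conjTranspose_kronecker, Matrix.conjTranspose_kronecker, conjTranspose_blockOperator,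
      Matrix.conjTranspose_one, Matrix.conjTranspose_one, kronecker_blockOperator_mul_entangler]
  -- Matrix units of `Q_l ⊗ Q_l` are products of matrix units on the factors, so `Z` commutes with
  -- all of them.
  have hC : Z ∈ Set.range (Matrix.scalar (Fin (q l) × Fin (q l))) := by
    rw [Matrix.mem_range_scalar_iff_commute_single']
    rintro ⟨a, b⟩ ⟨a', b'⟩
    have hs : Matrix.single (a, b) (a', b') (1 : ℂ) =
        (Matrix.single a a' 1 ⊗ₖ (1 : Matrix (Fin (q l)) (Fin (q l)) ℂ)) *
          ((1 : Matrix (Fin (q l)) (Fin (q l)) ℂ) ⊗ₖ Matrix.single b b' 1) := by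
      rw [← Matrix.mul_kronecker_mul, Matrix.mul_one, Matrix.one_mul,
        Matrix.single_kronecker_single, mul_one]
    rw [commute_iff_eq, hs, Matrix.mul_assoc, hB, ← Matrix.mul_assoc, hA, Matrix.mul_assoc]
  obtain ⟨r, hr⟩ := hC
  exact ⟨r, by rw [← hr, Matrix.scalar_apply, Matrix.smul_one_eq_diagonal]⟩

/-- `R = ∑ l, (1/q_l) (S_l ⊗ T_l)† (1 ⊗ 1 ⊗ |Γ⟩⟨Γ|) (S_l ⊗ T_l)` -/
theorem IsDual.R_eq_sum (hST : S.IsDual T) :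
    R d n = ∑ l, (q l : ℂ)⁻¹ • (S.entangler T l * (S.entangler T l)ᴴ) := by
  have hp : ∀ l, (p l : ℂ) ≠ 0 := fun l => by exact_mod_cast (S.p_pos l).ne'
  have hq : ∀ l, (q l : ℂ) ≠ 0 := fun l => by exact_mod_cast (S.q_pos l).ne'
  choose r hr using fun l => exists_conjTranspose_entangler_mul_R (S := S) (T := T) l
  have hproj := hST.symmProjection_mul_R
  have hproj' := congrArg Matrix.conjTranspose hproj
  simp only [Matrix.conjTranspose_mul, R_isHermitian, Matrix.conjTranspose_sum,
    Matrix.conjTranspose_smul, Matrix.conjTranspose_conjTranspose, star_inv₀, star_natCast] at hproj'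
  -- Compress `R` from both sides with the projection onto the symmetric subspace; each side
  -- contributes a factor `p⁻¹`, and cross terms vanish.
  have h1 : R d n = ∑ l, ((p l : ℂ)⁻¹ * (p l : ℂ)⁻¹ * r l) •
      (S.entangler T l * (S.entangler T l)ᴴ) := by
    conv_lhs => rw [← hproj, ← hproj']
    rw [← mul_assoc, Finset.sum_mul, Finset.sum_mul]
    refine Finset.sum_congr rfl fun l _ => ?_
    rw [Finset.mul_sum, Finset.sum_eq_single l]
    · rw [Matrix.smul_mul, Matrix.smul_mul, Matrix.mul_smul, smul_smul, ← Matrix.mul_assoc,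
        Matrix.mul_assoc _ _ (R d n), Matrix.mul_assoc _ (_ * R d n), hr, Matrix.mul_smul,
        Matrix.mul_one, Matrix.smul_mul, smul_smul]
    · intro l' _ h
      rw [Matrix.smul_mul, Matrix.smul_mul, Matrix.mul_smul, ← Matrix.mul_assoc,
        Matrix.mul_assoc _ _ (R d n), Matrix.mul_assoc _ (_ * R d n),
        conjTranspose_entangler_mul_R_of_ne h.symm, Matrix.mul_zero, Matrix.zero_mul, smul_zero,
        smul_zero]
    · simp
  -- Take the trace against the projection of `A^{⊗n}` onto block `l`: by `traceSnd_R` the left side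
  -- is `q p`, and the right side is the unknown coefficient times `p q²`.
  have h2 : ∀ l, (p l : ℂ)⁻¹ * (p l : ℂ)⁻¹ * r l = (q l : ℂ)⁻¹ := by
    intro l
    have ht := congrArg Matrix.trace (congrArg
      ((S.blockOperator l 1 ⊗ₖ (1 : Matrix (Fin n → d) (Fin n → d) ℂ)) * ·) h1)
    rw [trace_kronecker_one_mul, traceSnd_R, Matrix.mul_one, Finset.mul_sum,
      Finset.sum_eq_single l, Matrix.mul_smul, ← Matrix.mul_assoc,
      blockOperator_kronecker_mul_entangler, Matrix.one_kronecker_one, Matrix.mul_one,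
      Matrix.trace_smul, Matrix.trace_mul_comm, conjTranspose_entangler_mul_self,
      Matrix.trace_smul, Matrix.trace_one, blockOperator, Matrix.one_kronecker_one,
      Matrix.mul_one, Matrix.trace_mul_comm, block_mul_self, Matrix.trace_one] at ht
    · simp only [Fintype.card_prod, Fintype.card_fin, Nat.cast_mul, smul_eq_mul] at ht
      have := hp l
      have := hq l
      field_simp at ht ⊢
      linear_combination -ht
    · intro l' _ h
      rw [Matrix.mul_smul, ← Matrix.mul_assoc, blockOperator_kronecker_mul_entangler_of_ne S T h.symm,
        Matrix.zero_mul, smul_zero]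
    · simp
  rw [h1]
  exact Finset.sum_congr rfl fun l _ => by rw [h2]

/-- Each `E_l E_lᴴ` is `p l` times a projection and these are mutually orthogonal, so the
coefficient `c` of the root must satisfy `c² p = q⁻¹`. -/
lemma IsDual.sqrt_R (hST : S.IsDual T) :
    CFC.sqrt (R d n) = ∑ l, ((Real.sqrt (q l * p l))⁻¹ : ℂ) •
      (S.entangler T l * (S.entangler T l)ᴴ) := by
  refine CFC.sqrt_unique ?_ ?_
  · rw [hST.R_eq_sum, Finset.mul_sum]
    refine Finset.sum_congr rfl fun l _ => ?_
    rw [Matrix.mul_smul, ← Matrix.mul_assoc, sum_entangler_mul_conjTranspose_mul_entangler,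
      Matrix.smul_mul, smul_smul]
    congr 1
    have hp : (p l : ℂ) ≠ 0 := by exact_mod_cast (S.p_pos l).ne'
    have h : (Real.sqrt (q l * p l) : ℂ) * (Real.sqrt (q l * p l) : ℂ) = q l * p l := by
      rw [← Complex.ofReal_mul, Real.mul_self_sqrt (by positivity)]
      push_cast
      rfl
    rw [← mul_assoc, ← mul_inv, h, mul_inv, mul_assoc, inv_mul_cancel₀ hp, mul_one]
  · rw [Matrix.nonneg_iff_posSemidef]
    refine Matrix.posSemidef_sum _ fun l _ => ?_
    refine (Matrix.posSemidef_self_mul_conjTranspose _).smul ?_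
    rw [← Complex.ofReal_inv]
    exact Complex.zero_le_real.mpr (by positivity)

/-- In `√R (X ⊗ 1) √R` the terms with different labels vanish because the blocks of `T` are
orthogonal; this is the measurement of `l`. In the diagonal terms `E_lᴴ (X ⊗ 1) E_l` is the partial
trace over `P_l` tensored with 1, and the coefficients multiply to `(q p)⁻¹`, as in `prepare_eq`. -/
theorem IsDual.purify_eq_schurPurify (hST : S.IsDual T) (X : Matrix (Fin n → d) (Fin n → d) ℂ) :
    purify d n X = schurPurify S T X := by
  rw [purify_apply, hST.sqrt_R, schurPurify, Finset.sum_mul, Finset.sum_mul]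
  refine Finset.sum_congr rfl fun l _ => ?_
  rw [Finset.mul_sum, Finset.sum_eq_single l]
  · rw [prepare_eq, ← conjTranspose_entangler_mul_kronecker S T]
    have hc : (Real.sqrt (q l * p l) : ℂ)⁻¹ * (Real.sqrt (q l * p l) : ℂ)⁻¹ =
        (q l : ℂ)⁻¹ * (p l : ℂ)⁻¹ := by
      rw [← mul_inv, ← Complex.ofReal_mul, Real.mul_self_sqrt (by positivity)]
      push_cast
      rw [mul_inv]
    have hK : (S.entangler T l)ᴴ = (insertGamma (q l) (p l))ᴴ * (S.block l ⊗ₖ T.block l) := by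
      rw [entangler, Matrix.conjTranspose_mul, Matrix.conjTranspose_conjTranspose]
    rw [Matrix.smul_mul, Matrix.smul_mul, Matrix.mul_smul, smul_smul, hc, Matrix.mul_smul,
      Matrix.smul_mul]
    congr 1
    conv_lhs => enter [1, 1, 1]; rw [entangler]
    conv_lhs => enter [2, 2]; rw [hK]
    simp only [Matrix.mul_assoc]
  · intro l' _ h
    rw [Matrix.smul_mul, Matrix.smul_mul, Matrix.mul_smul, ← Matrix.mul_assoc, Matrix.mul_assoc _ _ (X ⊗ₖ _),
      Matrix.mul_assoc _ (_ * (X ⊗ₖ _)), conjTranspose_entangler_mul_kronecker_of_ne S T X h.symm,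
      Matrix.mul_zero, Matrix.zero_mul, smul_zero, smul_zero]
  · simp

end SchurTransform

end DualPair

/-! ### Irreducibility, equivalence and conjugation in terms of matrices -/

section MatrixRepresentations

variable {G : Type*} [Monoid G] {p p' : ℕ} {f : G →* Matrix (Fin p) (Fin p) ℂ}
  {g : G →* Matrix (Fin p') (Fin p') ℂ}

lemma isIrreducible_matRep_iff : (matRep f).IsIrreducible ↔ 0 < p ∧
    ∀ M : Submodule ℂ (Fin p → ℂ), (∀ x, ∀ v ∈ M, f x *ᵥ v ∈ M) → M = ⊥ ∨ M = ⊤ := by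
  constructor
  · intro hf
    refine ⟨dim_pos_of_isIrreducible hf, fun M hM => ?_⟩
    rcases hf.eq_bot_or_eq_top ⟨M, fun x v hv => hM x v hv⟩ with h | h
    · exact Or.inl (congrArg Subrepresentation.toSubmodule h)
    · exact Or.inr (congrArg Subrepresentation.toSubmodule h)
  · rintro ⟨hp, h⟩
    have hne : (⊥ : Subrepresentation (matRep f)) ≠ ⊤ := by
      intro hbt
      have h1 : (⊥ : Submodule ℂ (Fin p → ℂ)) = ⊤ := congrArg Subrepresentation.toSubmodule hbt
      have : Nonempty (Fin p) := ⟨⟨0, hp⟩⟩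
      exact bot_ne_top h1
    refine { exists_pair_ne := ⟨⊥, ⊤, hne⟩, eq_bot_or_eq_top := fun M => ?_ }
    rcases h M.toSubmodule fun x v hv => M.apply_mem_toSubmodule x hv with h | h
    · exact Or.inl (Subrepresentation.toSubmodule_injective h)
    · exact Or.inr (Subrepresentation.toSubmodule_injective h)

lemma nonempty_equiv_matRep_iff : Nonempty (Representation.Equiv (matRep f) (matRep g)) ↔
    ∃ (X : Matrix (Fin p') (Fin p) ℂ) (Y : Matrix (Fin p) (Fin p') ℂ), X * Y = 1 ∧ Y * X = 1 ∧
      ∀ x, X * f x = g x * X := by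
  constructor
  · rintro ⟨φ⟩
    refine ⟨LinearMap.toMatrix' φ.toLinearEquiv.toLinearMap,
      LinearMap.toMatrix' φ.toLinearEquiv.symm.toLinearMap, ?_, ?_, fun x => ?_⟩
    · rw [← LinearMap.toMatrix'_comp, LinearEquiv.comp_symm, LinearMap.toMatrix'_id]
    · rw [← LinearMap.toMatrix'_comp, LinearEquiv.symm_comp, LinearMap.toMatrix'_id]
    · apply (Matrix.toLin' (R := ℂ)).injective
      rw [Matrix.toLin'_mul, Matrix.toLin'_mul, Matrix.toLin'_toMatrix']
      exact φ.toIntertwiningMap.isIntertwining' x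
  · rintro ⟨X, Y, hXY, hYX, h⟩
    refine ⟨Representation.Equiv.mk (LinearEquiv.ofLinearMap (Matrix.toLin' X) (Matrix.toLin' Y)
      ?_ ?_) fun x => ?_⟩
    · rw [← Matrix.toLin'_mul, hXY, Matrix.toLin'_one]
    · rw [← Matrix.toLin'_mul, hYX, Matrix.toLin'_one]
    · exact (intertwiner X h).isIntertwining' x

/-- The entrywise complex conjugate of a matrix representation. -/
noncomputable def conjRep (f : G →* Matrix (Fin p) (Fin p) ℂ) : G →* Matrix (Fin p) (Fin p) ℂ :=
  ((starRingEnd ℂ).mapMatrix : Matrix (Fin p) (Fin p) ℂ →+* _).toMonoidHom.comp f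

lemma conjRep_apply (x : G) : conjRep f x = (f x).map star := rfl

/-- Entrywise conjugation carries invariant subspaces of one representation to invariant subspaces
of the other. -/
lemma isIrreducible_conjRep (hf : (matRep f).IsIrreducible) :
    (matRep (conjRep f)).IsIrreducible := by
  rw [isIrreducible_matRep_iff] at hf ⊢
  refine ⟨hf.1, fun M hM => ?_⟩
  let M' : Submodule ℂ (Fin p → ℂ) :=
    { carrier := {v | star v ∈ M}
      add_mem' := fun {v w} hv hw => by
        change star (v + w) ∈ M
        rw [star_add]
        exact M.add_mem hv hw
      zero_mem' := by
        change star 0 ∈ M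
        rw [star_zero]
        exact M.zero_mem
      smul_mem' := fun c v hv => by
        change star (c • v) ∈ M
        rw [star_smul]
        exact M.smul_mem _ hv }
  have hmem : ∀ v, v ∈ M' ↔ star v ∈ M := fun v => Iff.rfl
  rcases hf.2 M' fun x v hv => by
    rw [hmem] at hv ⊢
    have h : star (f x *ᵥ v) = conjRep f x *ᵥ star v := by
      ext i
      simp [conjRep_apply, Matrix.mulVec, dotProduct]
    rw [h]
    exact hM x _ hv with h | h
  · left
    rw [Submodule.eq_bot_iff] at h ⊢
    intro v hv
    rw [← star_eq_zero]
    exact h _ ((hmem _).mpr (by rwa [star_star]))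
  · right
    rw [Submodule.eq_top_iff'] at h ⊢
    intro v
    rw [← star_star v]
    exact (hmem _).mp (h _)

lemma isEmpty_equiv_conjRep (h : IsEmpty (Representation.Equiv (matRep f) (matRep g))) :
    IsEmpty (Representation.Equiv (matRep (conjRep f)) (matRep (conjRep g))) := by
  rw [← not_nonempty_iff, nonempty_equiv_matRep_iff] at h ⊢
  rintro ⟨X, Y, hXY, hYX, hX⟩
  have hs : ∀ {α β : Type} (M : Matrix α β ℂ),
      (M.map (starRingEnd ℂ)).map (starRingEnd ℂ) = M := fun M => by ext; simp
  refine h ⟨X.map (starRingEnd ℂ), Y.map (starRingEnd ℂ), ?_, ?_, fun x => ?_⟩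
  · rw [← Matrix.map_mul, hXY, Matrix.map_one _ (map_zero _) (map_one _)]
  · rw [← Matrix.map_mul, hYX, Matrix.map_one _ (map_zero _) (map_one _)]
  · have h1 := congrArg (Matrix.map · (starRingEnd ℂ)) (hX x)
    simp only [Matrix.map_mul] at h1
    have hf : (conjRep f x).map (starRingEnd ℂ) = f x := hs (f x)
    have hg : (conjRep g x).map (starRingEnd ℂ) = g x := hs (g x)
    rwa [hf, hg] at h1

end MatrixRepresentations

/-! ### Subspaces as ranges of isometries -/

section Isometries

variable {N : Type*} [Fintype N] [DecidableEq N]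

/-- Every subspace is the range of an isometry. -/
lemma exists_isometry_of_submodule (M : Submodule ℂ (N → ℂ)) :
    ∃ C : Matrix N (Fin (Module.finrank ℂ M)) ℂ, Cᴴ * C = 1 ∧ (∀ w, C *ᵥ w ∈ M) ∧
      ∀ v ∈ M, C *ᵥ (Cᴴ *ᵥ v) = v := by
  let e : EuclideanSpace ℂ N ≃ₗ[ℂ] (N → ℂ) := WithLp.linearEquiv 2 ℂ (N → ℂ)
  let M' : Submodule ℂ (EuclideanSpace ℂ N) := M.map e.symm.toLinearMap
  have hfin : Module.finrank ℂ M' = Module.finrank ℂ M :=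
    LinearEquiv.finrank_map_eq e.symm M
  have hmem : ∀ v, v ∈ M' ↔ e v ∈ M := fun v => by
    rw [Submodule.mem_map_equiv, LinearEquiv.symm_symm]
  let b := (stdOrthonormalBasis ℂ M').reindex (finCongr hfin)
  let C : Matrix N (Fin (Module.finrank ℂ M)) ℂ := Matrix.of fun i j => e (b j) i
  have hCmul : ∀ w, C *ᵥ w = e (∑ j, w j • (b j : EuclideanSpace ℂ N)) := by
    intro w
    ext i
    simp [C, Matrix.mulVec, dotProduct, map_sum, mul_comm]
  have hinner : ∀ (v : EuclideanSpace ℂ N) j, (Cᴴ *ᵥ e v) j = inner ℂ (b j : EuclideanSpace ℂ N) v := by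
    intro v j
    simp [C, Matrix.mulVec, dotProduct, PiLp.inner_apply, e, mul_comm]
  refine ⟨C, ?_, fun w => ?_, fun v hv => ?_⟩
  · ext i j
    have h := hinner (b j) i
    rw [← Submodule.coe_inner, OrthonormalBasis.inner_eq_ite] at h
    rw [Matrix.one_apply, ← h]
    rfl
  · rw [hCmul]
    exact (hmem _).mp (M'.sum_mem fun j _ => M'.smul_mem _ (b j).2)
  · have hv' : e.symm v ∈ M' := by
      rwa [hmem, e.apply_symm_apply]
    have h := congrArg (Submodule.subtype M') (b.sum_repr' ⟨_, hv'⟩)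
    rw [hCmul]
    conv_rhs => rw [← e.apply_symm_apply v]
    congr 1
    rw [map_sum] at h
    refine Eq.trans (Finset.sum_congr rfl fun j _ => ?_) h
    rw [map_smul, Submodule.subtype_apply, Submodule.coe_inner, ← hinner, e.apply_symm_apply]

end Isometries

/-! ### Irreducible subspaces of unitary representations -/

section IrreducibleSubspaces

variable {G : Type*} [Group G] {N : Type*} [Fintype N] [DecidableEq N]

/-- The representation on the range of an intertwining isometry. -/
noncomputable def compressHom {r : ℕ} (u : G →* Matrix N N ℂ) (B : Matrix N (Fin r) ℂ)
    (hB : Bᴴ * B = 1) (h : ∀ x, u x * B = B * (Bᴴ * u x * B)) :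
    G →* Matrix (Fin r) (Fin r) ℂ where
  toFun x := Bᴴ * u x * B
  map_one' := by rw [map_one, Matrix.mul_one, hB]
  map_mul' x y := by
    rw [map_mul, Matrix.mul_assoc (Bᴴ * u x), ← h, Matrix.mul_assoc _ _ B, Matrix.mul_assoc (u x),
      Matrix.mul_assoc]

/-- A nonzero invariant subspace of a unitary representation contains an irreducible one. -/
lemma exists_irreducible_isometry {u : G →* Matrix N N ℂ} (hu : ∀ x, (u x)ᴴ = u x⁻¹)
    {Q : Matrix N N ℂ} (hQ : Q * Q = Q) (hQ0 : Q ≠ 0) (hc : ∀ x, Commute (u x) Q) :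
    ∃ (p : ℕ) (f : G →* Matrix (Fin p) (Fin p) ℂ) (B : Matrix N (Fin p) ℂ),
      (matRep f).IsIrreducible ∧ (∀ x, (f x)ᴴ = f x⁻¹) ∧ Bᴴ * B = 1 ∧ Q * B = B ∧
        ∀ x, u x * B = B * f x := by
  classical
  -- `P r` says that the range of `Q` contains an invariant subspace of dimension `r > 0`. The least
  -- such `r` gives an irreducible one.
  let P : ℕ → Prop := fun r => 0 < r ∧ ∃ B : Matrix N (Fin r) ℂ, Bᴴ * B = 1 ∧ Q * B = B ∧
    ∀ x, u x * B = B * (Bᴴ * u x * B)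
  have hP : ∃ r, P r := by
    let M : Submodule ℂ (N → ℂ) := LinearMap.range (Matrix.toLin' Q)
    have hM : ∀ v, v ∈ M ↔ Q *ᵥ v = v := by
      intro v
      constructor
      · rintro ⟨w, rfl⟩
        rw [Matrix.toLin'_apply, Matrix.mulVec_mulVec, hQ]
      · intro h
        exact ⟨v, h⟩
    obtain ⟨C, hC1, hC2, hC3⟩ := exists_isometry_of_submodule M
    have hQC : Q * C = C := by
      refine Matrix.ext_of_mulVec_single fun i => ?_
      rw [← Matrix.mulVec_mulVec]
      exact (hM _).mp (hC2 _)
    refine ⟨Module.finrank ℂ M, ?_, C, hC1, hQC, fun x => ?_⟩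
    · rw [Module.finrank_pos_iff_exists_ne_zero]
      by_contra hcon
      push Not at hcon
      apply hQ0
      refine Matrix.ext_of_mulVec_single fun i => ?_
      rw [Matrix.zero_mulVec]
      exact congrArg Subtype.val (hcon ⟨Q *ᵥ Pi.single i 1, ⟨Pi.single i 1, rfl⟩⟩)
    · refine Matrix.ext_of_mulVec_single fun i => ?_
      rw [Matrix.mul_assoc, ← Matrix.mulVec_mulVec (M := C), ← Matrix.mulVec_mulVec (M := Cᴴ)]
      refine (hC3 _ ?_).symm
      rw [hM, Matrix.mulVec_mulVec, ← Matrix.mul_assoc, ← (hc x).eq, Matrix.mul_assoc, hQC]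
  obtain ⟨hp, B, hB, hQB, hint⟩ := Nat.find_spec hP
  refine ⟨Nat.find hP, compressHom u B hB hint, B, ?_, fun x => ?_, hB, hQB, hint⟩
  · rw [isIrreducible_matRep_iff]
    refine ⟨hp, fun M hM => ?_⟩
    by_cases hbot : M = ⊥
    · exact Or.inl hbot
    right
    obtain ⟨C, hC1, hC2, hC3⟩ := exists_isometry_of_submodule M
    -- A nonzero invariant `M`, embedded through `B`, is again such a subspace; minimality then
    -- forces full dimension.
    have hBC : P (Module.finrank ℂ M) := by
      refine ⟨Nat.pos_of_ne_zero fun h0 => hbot (Submodule.finrank_eq_zero.mp h0), B * C, ?_, ?_,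
        fun x => ?_⟩
      · rw [Matrix.conjTranspose_mul, Matrix.mul_assoc, ← Matrix.mul_assoc Bᴴ, hB, Matrix.one_mul,
          hC1]
      · rw [← Matrix.mul_assoc, hQB]
      · have h1 : Bᴴ * u x * B * C = C * (Cᴴ * (Bᴴ * u x * B * C)) := by
          refine Matrix.ext_of_mulVec_single fun i => ?_
          rw [← Matrix.mulVec_mulVec (N := Cᴴ * _), ← Matrix.mulVec_mulVec (M := Cᴴ)]
          refine (hC3 _ ?_).symm
          rw [← Matrix.mulVec_mulVec]
          exact hM x _ (hC2 _)
        rw [← Matrix.mul_assoc, hint, Matrix.mul_assoc B, h1, Matrix.conjTranspose_mul]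
        simp only [Matrix.mul_assoc]
    have hle := Nat.find_min' hP hBC
    apply Submodule.eq_top_of_finrank_eq
    refine le_antisymm (Submodule.finrank_le M) ?_
    rwa [Module.finrank_fin_fun]
  · change (Bᴴ * u x * B)ᴴ = Bᴴ * u x⁻¹ * B
    rw [Matrix.conjTranspose_mul, Matrix.conjTranspose_mul, hu, Matrix.conjTranspose_conjTranspose,
      Matrix.mul_assoc]

end IrreducibleSubspaces

/-! ### Unitary irreducible representations up to equivalence -/

section UnitaryIrreps

/-- Irreducible representations by unitary matrices. -/
structure UnitaryIrrep (G : Type*) [Group G] where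
  dim : ℕ
  hom : G →* Matrix (Fin dim) (Fin dim) ℂ
  irreducible : (matRep hom).IsIrreducible
  unitary : ∀ x, (hom x)ᴴ = hom x⁻¹

variable {G : Type*} [Group G]

namespace UnitaryIrrep

lemma dim_pos (x : UnitaryIrrep G) : 0 < x.dim := dim_pos_of_isIrreducible x.irreducible

/-- Equivalence of representations. -/
instance setoid : Setoid (UnitaryIrrep G) where
  r x y := Nonempty (Representation.Equiv (matRep x.hom) (matRep y.hom))
  iseqv :=
    { refl := fun _ => ⟨Representation.Equiv.refl _⟩
      symm := fun ⟨e⟩ => ⟨e.symm⟩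
      trans := fun ⟨e⟩ ⟨e'⟩ => ⟨e.trans e'⟩ }

/-- A distinguished representative of each equivalence class. -/
noncomputable def canon (x : UnitaryIrrep G) : UnitaryIrrep G := (Quotient.mk setoid x).out

lemma canon_equiv (x : UnitaryIrrep G) :
    Nonempty (Representation.Equiv (matRep x.canon.hom) (matRep x.hom)) :=
  Quotient.mk_out (s := setoid) x

lemma canon_eq {x y : UnitaryIrrep G}
    (h : Nonempty (Representation.Equiv (matRep x.hom) (matRep y.hom))) : x.canon = y.canon :=
  congrArg Quotient.out (Quotient.sound (s := setoid) h)

lemma canon_canon (x : UnitaryIrrep G) : x.canon.canon = x.canon := canon_eq x.canon_equiv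

/-- Equivalent irreducible unitary representations are unitarily equivalent. -/
lemma exists_unitary_intertwiner {x y : UnitaryIrrep G}
    (h : Nonempty (Representation.Equiv (matRep x.hom) (matRep y.hom))) :
    ∃ X : Matrix (Fin y.dim) (Fin x.dim) ℂ, Xᴴ * X = 1 ∧ ∀ g, y.hom g * X = X * x.hom g := by
  obtain ⟨X, Y, -, hYX, hX⟩ := nonempty_equiv_matRep_iff.mp h
  have hX' : ∀ g, Xᴴ * y.hom g = x.hom g * Xᴴ := fun g => by
    have := congrArg Matrix.conjTranspose (hX g⁻¹)
    simpa only [Matrix.conjTranspose_mul, x.unitary, y.unitary, inv_inv] using this.symm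
  -- By unitarity `Xᴴ X` is an intertwiner, hence a scalar, which is positive as `X` is invertible;
  -- dividing by its root makes `X` an isometry.
  obtain ⟨c, hcX⟩ := exists_eq_smul_one_of_intertwining (A := Xᴴ * X) x.irreducible fun g => by
    rw [Matrix.mul_assoc, hX, ← Matrix.mul_assoc, hX', Matrix.mul_assoc]
  let i : Fin x.dim := ⟨0, x.dim_pos⟩
  have hc0 : 0 ≤ c := by
    have h1 := (Matrix.posSemidef_conjTranspose_mul_self X).diag_nonneg (i := i)
    rw [hcX] at h1
    simpa using h1
  have hcne : c ≠ 0 := by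
    rintro rfl
    rw [zero_smul, Matrix.conjTranspose_mul_self_eq_zero] at hcX
    have h1 := congrFun (congrFun hYX i) i
    rw [hcX, Matrix.mul_zero] at h1
    simp at h1
  have hcr : (c.re : ℂ) = c := Complex.ext rfl (Complex.nonneg_iff.mp hc0).2
  have hs : (Real.sqrt c.re : ℂ) * (Real.sqrt c.re : ℂ) = c := by
    rw [← Complex.ofReal_mul, Real.mul_self_sqrt (Complex.nonneg_iff.mp hc0).1, hcr]
  refine ⟨(Real.sqrt c.re : ℂ)⁻¹ • X, ?_, fun g => ?_⟩
  · rw [Matrix.conjTranspose_smul, Matrix.smul_mul, Matrix.mul_smul, smul_smul, hcX, smul_smul,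
      star_inv₀]
    have : star (Real.sqrt c.re : ℂ) = (Real.sqrt c.re : ℂ) := Complex.conj_ofReal _
    rw [this, ← mul_inv, hs, inv_mul_cancel₀ hcne, one_smul]
  · rw [Matrix.mul_smul, Matrix.smul_mul, hX]

end UnitaryIrrep

end UnitaryIrreps

/-! ### Complete reducibility by maximal orthogonal families -/

section Frames

variable {G : Type*} [Group G] {N : Type*} [Fintype N] [DecidableEq N]

/-- A family of intertwining isometries, with pairwise orthogonal ranges, from irreducible
representations, no two of which are equivalent but different. -/
structure IsFrame (u : G →* Matrix N N ℂ)
    (F : Finset (Σ y : UnitaryIrrep G, Matrix N (Fin y.dim) ℂ)) : Prop where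
  canon_eq : ∀ z ∈ F, z.1.canon = z.1
  isometry : ∀ z ∈ F, z.2ᴴ * z.2 = 1
  intertwines : ∀ z ∈ F, ∀ x, u x * z.2 = z.2 * z.1.hom x
  orthogonal : ∀ z ∈ F, ∀ w ∈ F, z ≠ w → z.2ᴴ * w.2 = 0

/-- The projection onto the span of the ranges. -/
noncomputable def frameProj (F : Finset (Σ y : UnitaryIrrep G, Matrix N (Fin y.dim) ℂ)) :
    Matrix N N ℂ := ∑ z ∈ F, z.2 * z.2ᴴ

variable {u : G →* Matrix N N ℂ} {F : Finset (Σ y : UnitaryIrrep G, Matrix N (Fin y.dim) ℂ)}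

lemma frameProj_conjTranspose : (frameProj F)ᴴ = frameProj F := by
  simp [frameProj, Matrix.conjTranspose_sum, Matrix.conjTranspose_mul]

lemma IsFrame.conjTranspose_mul_frameProj (hF : IsFrame u F)
    {z : Σ y : UnitaryIrrep G, Matrix N (Fin y.dim) ℂ} (hz : z ∈ F) :
    z.2ᴴ * frameProj F = z.2ᴴ := by
  rw [frameProj, Matrix.mul_sum, Finset.sum_eq_single_of_mem z hz, ← Matrix.mul_assoc,
    hF.isometry z hz, Matrix.one_mul]
  intro w hw hwz
  rw [← Matrix.mul_assoc, hF.orthogonal z hz w hw hwz.symm, Matrix.zero_mul]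

lemma IsFrame.frameProj_mul_self (hF : IsFrame u F) :
    frameProj F * frameProj F = frameProj F := by
  conv_lhs => enter [1]; rw [frameProj]
  rw [Finset.sum_mul]
  refine Finset.sum_congr rfl fun z hz => ?_
  rw [Matrix.mul_assoc, hF.conjTranspose_mul_frameProj hz]

lemma IsFrame.commute_frameProj (hu : ∀ x, (u x)ᴴ = u x⁻¹) (hF : IsFrame u F) (x : G) :
    Commute (u x) (frameProj F) := by
  rw [commute_iff_eq, frameProj, Finset.mul_sum, Finset.sum_mul]
  refine Finset.sum_congr rfl fun z hz => ?_
  have h := congrArg Matrix.conjTranspose (hF.intertwines z hz x⁻¹)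
  rw [Matrix.conjTranspose_mul, Matrix.conjTranspose_mul, hu, z.1.unitary, inv_inv] at h
  rw [Matrix.mul_assoc, h, ← Matrix.mul_assoc, ← Matrix.mul_assoc, hF.intertwines z hz]

/-- The trace of the projection is the sum of the dimensions, each at least 1, and is at most the
dimension of the space. The bound ensures that a frame of maximal size exists. -/
lemma IsFrame.card_le (hF : IsFrame u F) : F.card ≤ Fintype.card N := by
  have h1 : (1 - frameProj F)ᴴ * (1 - frameProj F) = 1 - frameProj F := by
    rw [Matrix.conjTranspose_sub, Matrix.conjTranspose_one, frameProj_conjTranspose, mul_sub,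
      mul_one, sub_mul, one_mul, hF.frameProj_mul_self, sub_self, sub_zero]
  have h2 := (Matrix.posSemidef_conjTranspose_mul_self (1 - frameProj F)).trace_nonneg
  have h3 : (frameProj F).trace = ((∑ z ∈ F, z.1.dim : ℕ) : ℂ) := by
    rw [frameProj, Matrix.trace_sum, Nat.cast_sum]
    refine Finset.sum_congr rfl fun z hz => ?_
    rw [Matrix.trace_mul_comm, hF.isometry z hz, Matrix.trace_one, Fintype.card_fin]
  rw [h1, Matrix.trace_sub, Matrix.trace_one, h3, sub_nonneg, Nat.cast_le] at h2
  refine le_trans ?_ h2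
  rw [Finset.card_eq_sum_ones]
  exact Finset.sum_le_sum fun z _ => z.1.dim_pos

/-- A unitary representation is an orthogonal sum of irreducible ones, with equal matrices for
equivalent summands. -/
lemma exists_complete_frame (hu : ∀ x, (u x)ᴴ = u x⁻¹) :
    ∃ F : Finset (Σ y : UnitaryIrrep G, Matrix N (Fin y.dim) ℂ),
      IsFrame u F ∧ frameProj F = 1 := by
  classical
  let P : ℕ → Prop := fun k => ∃ F, IsFrame u F ∧ F.card = k
  have hP0 : P 0 := ⟨∅, ⟨by simp, by simp, by simp, by simp⟩, rfl⟩
  obtain ⟨F, hF, hcard⟩ := Nat.findGreatest_spec (P := P) (Nat.zero_le (Fintype.card N)) hP0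
  refine ⟨F, hF, ?_⟩
  by_contra hne
  -- If the maximal frame is incomplete, the orthogonal complement contains a further irreducible
  -- subspace, which would enlarge the frame.
  obtain ⟨p, f, B, hf, hfu, hB, hQB, hint⟩ := exists_irreducible_isometry hu
    (Q := 1 - frameProj F)
    (by rw [mul_sub, mul_one, sub_mul, one_mul, hF.frameProj_mul_self, sub_self, sub_zero])
    (fun h => hne (sub_eq_zero.mp h).symm)
    (fun x => (Commute.one_right _).sub_right (hF.commute_frameProj hu x))
  let y : UnitaryIrrep G := ⟨p, f, hf, hfu⟩
  -- Passing to the representative of the class makes equivalent summands carry identical matrices.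
  obtain ⟨X, hX, hXint⟩ := UnitaryIrrep.exists_unitary_intertwiner y.canon_equiv
  change Matrix (Fin p) _ ℂ at X
  change ∀ g, f g * X = X * _ at hXint
  let z : Σ y : UnitaryIrrep G, Matrix N (Fin y.dim) ℂ := ⟨y.canon, B * X⟩
  have hz1 : z.2ᴴ * z.2 = 1 := by
    change (B * X)ᴴ * (B * X) = 1
    rw [Matrix.conjTranspose_mul, Matrix.mul_assoc, ← Matrix.mul_assoc Bᴴ, hB, Matrix.one_mul, hX]
  have horth : ∀ w ∈ F, w.2ᴴ * z.2 = 0 := by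
    intro w hw
    change w.2ᴴ * (B * X) = 0
    rw [← hQB, ← Matrix.mul_assoc, ← Matrix.mul_assoc, Matrix.mul_sub, Matrix.mul_one,
      hF.conjTranspose_mul_frameProj hw, sub_self, Matrix.zero_mul, Matrix.zero_mul]
  have hzF : z ∉ F := by
    intro h
    have h1 := horth z h
    rw [hz1] at h1
    have h2 := congrFun (congrFun h1 ⟨0, z.1.dim_pos⟩) ⟨0, z.1.dim_pos⟩
    simp at h2
  have hF' : IsFrame u (insert z F) := by
    refine ⟨?_, ?_, ?_, ?_⟩
    · intro w hw
      rcases Finset.mem_insert.mp hw with rfl | hw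
      · exact y.canon_canon
      · exact hF.canon_eq w hw
    · intro w hw
      rcases Finset.mem_insert.mp hw with rfl | hw
      · exact hz1
      · exact hF.isometry w hw
    · intro w hw x
      rcases Finset.mem_insert.mp hw with rfl | hw
      · change u x * (B * X) = B * X * y.canon.hom x
        rw [← Matrix.mul_assoc, hint, Matrix.mul_assoc, hXint, Matrix.mul_assoc]
      · exact hF.intertwines w hw x
    · intro w hw w' hw' hne'
      rcases Finset.mem_insert.mp hw with rfl | hw <;> rcases Finset.mem_insert.mp hw' with rfl | hw'
      · exact absurd rfl hne'
      · rw [← Matrix.conjTranspose_eq_zero, Matrix.conjTranspose_mul,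
          Matrix.conjTranspose_conjTranspose]
        exact horth _ hw'
      · exact horth _ hw
      · exact hF.orthogonal w hw w' hw' hne'
  have hle : F.card + 1 ≤ Nat.findGreatest P (Fintype.card N) := by
    have hc : (insert z F).card = F.card + 1 := Finset.card_insert_of_notMem hzF
    rw [← hc]
    exact Nat.le_findGreatest hF'.card_le ⟨_, hF', rfl⟩
  omega

end Frames

/-! ### The isotypic decomposition -/

section IsotypicDecomposition

variable {G : Type*} [Group G] {N : Type*} [Fintype N] [DecidableEq N]

/-- The isotypic decomposition of a unitary representation `u`: in a suitable orthonormal basis it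
is `⨁_l 1 ⊗ f l` with pairwise inequivalent irreducible representations `f l`. -/
theorem exists_isotypic_decomposition {u : G →* Matrix N N ℂ} (hu : ∀ x, (u x)ᴴ = u x⁻¹) :
    ∃ (k : ℕ) (q p : Fin k → ℕ) (W : Matrix (Σ l, Fin (q l) × Fin (p l)) N ℂ)
      (f : ∀ l, G →* Matrix (Fin (p l)) (Fin (p l)) ℂ), W * Wᴴ = 1 ∧ Wᴴ * W = 1 ∧
      (∀ l, 0 < q l) ∧ (∀ l, (matRep (f l)).IsIrreducible) ∧
      (∀ l l', l ≠ l' → IsEmpty (Representation.Equiv (matRep (f l)) (matRep (f l')))) ∧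
      ∀ x, W * u x * Wᴴ = Matrix.blockDiagonal' fun l =>
        (1 : Matrix (Fin (q l)) (Fin (q l)) ℂ) ⊗ₖ f l x := by
  classical
  obtain ⟨F, hF, hF1⟩ := exists_complete_frame hu
  -- Labels enumerate the representatives that occur in the frame; the multiplicity `q l` is the
  -- number of isometries in the frame attached to label `l`.
  let e : Fin (F.image Sigma.fst).card ≃ F.image Sigma.fst := (F.image Sigma.fst).equivFin.symm
  let y : Fin (F.image Sigma.fst).card → UnitaryIrrep G := fun l => (e l).1
  have hyinj : Function.Injective y := fun l l' h => e.injective (Subtype.ext h)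
  let fiber : UnitaryIrrep G → Type _ := fun z => {B : Matrix N (Fin z.dim) ℂ // ⟨z, B⟩ ∈ F}
  have hfin : ∀ z, Finite (fiber z) := fun z =>
    Finite.of_injective (β := F) (fun B => ⟨⟨z, B.1⟩, B.2⟩) fun B C h =>
      Subtype.ext (eq_of_heq (Sigma.mk.inj (congrArg Subtype.val h)).2)
  let q : Fin (F.image Sigma.fst).card → ℕ := fun l => Nat.card (fiber (y l))
  let a : ∀ l, Fin (q l) ≃ fiber (y l) := fun l => (Finite.equivFin _).symm
  let V : ∀ l, Fin (q l) → Matrix N (Fin (y l).dim) ℂ := fun l i => (a l i).1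
  have hV : ∀ l i, (⟨y l, V l i⟩ : Σ y : UnitaryIrrep G, Matrix N (Fin y.dim) ℂ) ∈ F :=
    fun l i => (a l i).2
  have hVinj : ∀ l i l' i', (⟨y l, V l i⟩ : Σ y : UnitaryIrrep G, Matrix N (Fin y.dim) ℂ) =
      ⟨y l', V l' i'⟩ → (⟨l, i⟩ : Σ l, Fin (q l)) = ⟨l', i'⟩ := by
    intro l i l' i' h
    obtain rfl : l = l' := hyinj (Sigma.mk.inj h).1
    rw [(a l).injective (Subtype.ext (eq_of_heq (Sigma.mk.inj h).2))]
  have hymem : ∀ l, ∃ B, (⟨y l, B⟩ : Σ y : UnitaryIrrep G, Matrix N (Fin y.dim) ℂ) ∈ F := by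
    intro l
    obtain ⟨z, hz, hzl⟩ := Finset.mem_image.mp (e l).2
    change z.1 = y l at hzl
    rw [← hzl]
    exact ⟨z.2, hz⟩
  have hq : ∀ l, 0 < q l := by
    intro l
    obtain ⟨B, hB⟩ := hymem l
    have : Nonempty (fiber (y l)) := ⟨⟨B, hB⟩⟩
    have := hfin (y l)
    exact Nat.card_pos
  let W : Matrix (Σ l, Fin (q l) × Fin (y l).dim) N ℂ := Matrix.of fun x i =>
    star (V x.1 x.2.1 i x.2.2)
  have hWX : ∀ (X : Matrix N N ℂ) l i j l' i' j', (W * X * Wᴴ) ⟨l, i, j⟩ ⟨l', i', j'⟩ =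
      ((V l i)ᴴ * X * V l' i') j j' := by
    intro X l i j l' i' j'
    simp [W, Matrix.mul_apply]
  have hWu : ∀ x, W * u x * Wᴴ = Matrix.blockDiagonal' fun l =>
      (1 : Matrix (Fin (q l)) (Fin (q l)) ℂ) ⊗ₖ (y l).hom x := by
    intro x
    ext ⟨l, i, j⟩ ⟨l', i', j'⟩
    rw [hWX, Matrix.mul_assoc, hF.intertwines _ (hV l' i'), ← Matrix.mul_assoc]
    by_cases h : (⟨l, i⟩ : Σ l, Fin (q l)) = ⟨l', i'⟩
    · obtain ⟨rfl, h2⟩ := Sigma.mk.inj h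
      obtain rfl := eq_of_heq h2
      rw [hF.isometry _ (hV l i), Matrix.one_mul, Matrix.blockDiagonal'_apply_eq,
        Matrix.kroneckerMap_apply, Matrix.one_apply_eq, one_mul]
    · rw [hF.orthogonal _ (hV l i) _ (hV l' i') fun h' => h (hVinj _ _ _ _ h'), Matrix.zero_mul,
        Matrix.zero_apply]
      by_cases hl : l = l'
      · subst hl
        have hi : i ≠ i' := fun hi => h (by rw [hi])
        rw [Matrix.blockDiagonal'_apply_eq, Matrix.kroneckerMap_apply, Matrix.one_apply_ne hi,
          zero_mul]
      · rw [Matrix.blockDiagonal'_apply_ne _ _ _ hl]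
  refine ⟨_, q, fun l => (y l).dim, W, fun l => (y l).hom, ?_, ?_, hq,
    fun l => (y l).irreducible, fun l l' hl => ?_, hWu⟩
  · have h := hWu 1
    simp only [map_one, Matrix.mul_one, Matrix.one_kronecker_one] at h
    rw [h]
    exact Matrix.blockDiagonal'_one
  · rw [← hF1, frameProj]
    ext i i'
    rw [Matrix.sum_apply, Matrix.mul_apply, Fintype.sum_sigma]
    simp only [Fintype.sum_prod_type]
    rw [← Fintype.sum_sigma' fun l b => ∑ j, Wᴴ i ⟨l, b, j⟩ * W ⟨l, b, j⟩ i']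
    refine Finset.sum_bij (fun x _ => ⟨y x.1, V x.1 x.2⟩) (fun x _ => hV x.1 x.2)
      (fun x _ x' _ h => hVinj _ _ _ _ h) ?_ fun x _ => ?_
    · rintro ⟨z, B⟩ hz
      obtain ⟨l, rfl⟩ : ∃ l, y l = z := ⟨e.symm ⟨z, Finset.mem_image_of_mem Sigma.fst hz⟩, by
        simp [y]⟩
      refine ⟨⟨l, (a l).symm ⟨B, hz⟩⟩, Finset.mem_univ _, ?_⟩
      simp [V]
    · simp [W, Matrix.mul_apply]
  · rw [← not_nonempty_iff]
    intro h
    apply hl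
    apply hyinj
    obtain ⟨B, hB⟩ := hymem l
    obtain ⟨B', hB'⟩ := hymem l'
    exact (hF.canon_eq _ hB).symm.trans ((UnitaryIrrep.canon_eq h).trans (hF.canon_eq _ hB'))

end IsotypicDecomposition

/-! ### Construction of a dual pair of Schur transforms -/

section Construction

variable {d : Type*} [Fintype d] [DecidableEq d] {n k : ℕ} {q p : Fin k → ℕ}
  {W : Matrix (Σ l, Fin (q l) × Fin (p l)) (Fin n → d) ℂ}
  {f : ∀ l, Equiv.Perm (Fin n) →* Matrix (Fin (p l)) (Fin (p l)) ℂ}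

/-- The compression of an operator to the `l`-th block, followed by the normalised partial trace
over the second factor. -/
noncomputable def compress (W : Matrix (Σ l, Fin (q l) × Fin (p l)) (Fin n → d) ℂ) (l : Fin k) :
    Matrix (Fin n → d) (Fin n → d) ℂ →ₗ[ℂ] Matrix (Fin (q l)) (Fin (q l)) ℂ where
  toFun X := (p l : ℂ)⁻¹ • traceSnd (rowBlock W l * X * (rowBlock W l)ᴴ)
  map_add' X Y := by
    rw [Matrix.mul_add, Matrix.add_mul, ← smul_add]
    exact congrArg _ (map_add traceSndLin _ _)
  map_smul' c X := by
    rw [Matrix.mul_smul, Matrix.smul_mul, RingHom.id_apply, smul_comm c]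
    exact congrArg _ (map_smul traceSndLin _ _)

lemma compress_apply (l : Fin k) (X : Matrix (Fin n → d) (Fin n → d) ℂ) :
    compress W l X = (p l : ℂ)⁻¹ • traceSnd (rowBlock W l * X * (rowBlock W l)ᴴ) := rfl

lemma compress_eq_of_eq {l : Fin k} (hp : 0 < p l) {X : Matrix (Fin n → d) (Fin n → d) ℂ}
    {z : Matrix (Fin (q l)) (Fin (q l)) ℂ} (h : rowBlock W l * X * (rowBlock W l)ᴴ =
      z ⊗ₖ (1 : Matrix (Fin (p l)) (Fin (p l)) ℂ)) : compress W l X = z := by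
  have hp' : (p l : ℂ) ≠ 0 := by exact_mod_cast hp.ne'
  rw [compress_apply, h]
  ext i j
  simp [traceSnd, Matrix.kroneckerMap_apply]
  field_simp

variable (hW' : Wᴴ * W = 1) (hf : ∀ l, (matRep (f l)).IsIrreducible)
  (hfne : ∀ l l', l ≠ l' → IsEmpty (Representation.Equiv (matRep (f l)) (matRep (f l'))))
  (hWf : ∀ π : Equiv.Perm (Fin n), W * (permMatrix π : Matrix (Fin n → d) (Fin n → d) ℂ) * Wᴴ =
    Matrix.blockDiagonal' fun l => (1 : Matrix (Fin (q l)) (Fin (q l)) ℂ) ⊗ₖ f l π)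

include hW' hWf in
lemma rowBlock_conj_intertwines {X : Matrix (Fin n → d) (Fin n → d) ℂ} (hX : IsPermSymmetric X)
    (l l' : Fin k) (π : Equiv.Perm (Fin n)) :
    (rowBlock W l * X * (rowBlock W l')ᴴ) *
        ((1 : Matrix (Fin (q l')) (Fin (q l')) ℂ) ⊗ₖ f l' π) =
      ((1 : Matrix (Fin (q l)) (Fin (q l)) ℂ) ⊗ₖ f l π) *
        (rowBlock W l * X * (rowBlock W l')ᴴ) := by
  rw [Matrix.mul_assoc, ← mul_conjTranspose_rowBlock_eq hW' (hWf π), ← Matrix.mul_assoc,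
    ← Matrix.mul_assoc, ← Matrix.mul_assoc, ← rowBlock_mul_eq hW' (hWf π),
    Matrix.mul_assoc (rowBlock W l) X, Matrix.mul_assoc (rowBlock W l) (permMatrix π),
    (isPermSymmetric_iff_commute.mp hX π).eq]

include hW' hf hfne hWf in
lemma rowBlock_conj_of_ne {X : Matrix (Fin n → d) (Fin n → d) ℂ} (hX : IsPermSymmetric X)
    {l l' : Fin k} (h : l ≠ l') : rowBlock W l * X * (rowBlock W l')ᴴ = 0 :=
  eq_zero_of_one_kronecker_intertwining (hf l') (hf l) (hfne l' l h.symm)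
    (rowBlock_conj_intertwines hW' hWf hX l l')

include hW' hf hWf in
lemma rowBlock_conj_self {X : Matrix (Fin n → d) (Fin n → d) ℂ} (hX : IsPermSymmetric X)
    (l : Fin k) : rowBlock W l * X * (rowBlock W l)ᴴ =
      compress W l X ⊗ₖ (1 : Matrix (Fin (p l)) (Fin (p l)) ℂ) := by
  obtain ⟨z, hz⟩ := eq_kronecker_one_of_one_kronecker_intertwining (hf l)
    (rowBlock_conj_intertwines hW' hWf hX l l)
  rw [compress_eq_of_eq (dim_pos_of_isIrreducible (hf l)) hz, hz]

include hW' hf hfne hWf in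
-- Symmetric operators have no off-diagonal blocks, and their diagonal blocks are `z ⊗ 1`, so blocks
-- multiply separately. This makes compressing `U^{⊗n}` a representation of the unitary group.
lemma compress_mul {X Y : Matrix (Fin n → d) (Fin n → d) ℂ} (hX : IsPermSymmetric X)
    (hY : IsPermSymmetric Y) (l : Fin k) :
    compress W l (X * Y) = compress W l X * compress W l Y := by
  refine compress_eq_of_eq (dim_pos_of_isIrreducible (hf l)) ?_
  have h : rowBlock W l * (X * Y) * (rowBlock W l)ᴴ =
      ∑ l', (rowBlock W l * X * (rowBlock W l')ᴴ) * (rowBlock W l' * Y * (rowBlock W l)ᴴ) := by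
    conv_lhs => rw [← Matrix.mul_one X, ← sum_conjTranspose_mul_rowBlock hW', Matrix.mul_sum,
      Finset.sum_mul, Matrix.mul_sum, Matrix.sum_mul]
    refine Finset.sum_congr rfl fun l' _ => ?_
    simp only [Matrix.mul_assoc]
  rw [h, Finset.sum_eq_single l]
  · rw [rowBlock_conj_self hW' hf hWf hX, rowBlock_conj_self hW' hf hWf hY,
      ← Matrix.mul_kronecker_mul, Matrix.one_mul]
  · intro l' _ hl
    rw [rowBlock_conj_of_ne hW' hf hfne hWf hX hl.symm, Matrix.zero_mul]
  · simp

lemma compress_one (hW : W * Wᴴ = 1) {l : Fin k} (hp : 0 < p l) : compress W l 1 = 1 := by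
  refine compress_eq_of_eq hp ?_
  rw [Matrix.mul_one, rowBlock_mul_conjTranspose_self hW, Matrix.one_kronecker_one]

lemma compress_rowBlock_conj (hW : W * Wᴴ = 1) {l : Fin k} (hp : 0 < p l)
    (m : Matrix (Fin (q l)) (Fin (q l)) ℂ) :
    compress W l ((rowBlock W l)ᴴ * (m ⊗ₖ (1 : Matrix (Fin (p l)) (Fin (p l)) ℂ)) *
      rowBlock W l) = m := by
  refine compress_eq_of_eq hp ?_
  rw [Matrix.mul_assoc, Matrix.mul_assoc, rowBlock_mul_conjTranspose_self hW, Matrix.mul_one,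
    ← Matrix.mul_assoc, rowBlock_mul_conjTranspose_self hW, Matrix.one_mul]

lemma compress_rowBlock_conj_of_ne (hW : W * Wᴴ = 1) {l l' : Fin k} (h : l' ≠ l)
    (hp : 0 < p l') (m : Matrix (Fin (q l)) (Fin (q l)) ℂ) :
    compress W l' ((rowBlock W l)ᴴ * (m ⊗ₖ (1 : Matrix (Fin (p l)) (Fin (p l)) ℂ)) *
      rowBlock W l) = 0 := by
  refine compress_eq_of_eq hp ?_
  rw [Matrix.mul_assoc, Matrix.mul_assoc, ← Matrix.mul_assoc (rowBlock W l'),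
    ← Matrix.mul_assoc (rowBlock W l'), rowBlock_mul_conjTranspose_of_ne hW h, Matrix.zero_mul,
    Matrix.zero_mul, Matrix.zero_kronecker]

/-- A rank one matrix `w v†` takes a nonzero `v` in `M` to a nonzero multiple of any prescribed `w`.
-/
lemma eq_bot_or_eq_top_of_forall_matrix {r : ℕ} (M : Submodule ℂ (Fin r → ℂ))
    (hM : ∀ (m : Matrix (Fin r) (Fin r) ℂ), ∀ v ∈ M, m *ᵥ v ∈ M) : M = ⊥ ∨ M = ⊤ := by
  by_cases h : M = ⊥
  · exact Or.inl h
  obtain ⟨v, hv, hv0⟩ := Submodule.exists_mem_ne_zero_of_ne_bot h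
  refine Or.inr (Submodule.eq_top_iff'.mpr fun w => ?_)
  have hs : star v ⬝ᵥ v ≠ 0 := fun h0 => hv0 (dotProduct_star_self_eq_zero.mp h0)
  have h1 := M.smul_mem (star v ⬝ᵥ v)⁻¹ (hM (Matrix.vecMulVec w (star v)) v hv)
  have h2 : (star v ⬝ᵥ v)⁻¹ • (Matrix.vecMulVec w (star v) *ᵥ v) = w := by
    rw [Matrix.vecMulVec_mulVec]
    ext i
    simp
    field_simp
  rwa [h2] at h1

include hW' hf hfne hWf in
/-- A unitary decomposing the representation of `S_n` into isotypic components is a Schur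
transform. -/
theorem exists_schurTransform (hW : W * Wᴴ = 1) (hq : ∀ l, 0 < q l) :
    ∃ S : SchurTransform d n (Fin k) q p, S.permRep = f := by
  have hp : ∀ l, 0 < p l := fun l => dim_pos_of_isIrreducible (hf l)
  let g : ∀ l, Matrix.unitaryGroup d ℂ →* Matrix (Fin (q l)) (Fin (q l)) ℂ := fun l =>
    { toFun := fun U => compress W l (tensorPow n (U : Matrix d d ℂ))
      map_one' := by
        change compress W l (tensorPow n 1) = 1
        rw [tensorPow_one, compress_one hW (hp l)]
      map_mul' := fun U V => by
        change compress W l (tensorPow n ((U : Matrix d d ℂ) * (V : Matrix d d ℂ))) = _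
        rw [tensorPow_mul, compress_mul hW' hf hfne hWf (isPermSymmetric_tensorPow _)
          (isPermSymmetric_tensorPow _)] }
  have hg : ∀ l U, g l U = compress W l (tensorPow n (U : Matrix d d ℂ)) := fun _ _ => rfl
  have hsymm := isPermSymmetric_rowBlock_conj hW' hWf
  refine ⟨{ W := W, W_mul_conjTranspose := hW, conjTranspose_mul_W := hW', permRep := f,
            unitaryRep := g, permRep_irreducible := hf, unitaryRep_irreducible := fun l => ?_,
            permRep_inequivalent := hfne, unitaryRep_inequivalent := fun l l' hl => ?_,
            W_perm := hWf, W_unitary := fun U => ?_ }, rfl⟩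
  · rw [isIrreducible_matRep_iff]
    refine ⟨hq l, fun M hM => eq_bot_or_eq_top_of_forall_matrix M fun m v hv => ?_⟩
    -- Every matrix `m` on `Q_l` is the compression of a symmetric operator, hence a combination of
    -- the matrices representing `U(d)`; a subspace invariant under the latter is invariant under
    -- all matrices.
    rw [← compress_rowBlock_conj hW (hp l) m]
    generalize hXm : (rowBlock W l)ᴴ * (m ⊗ₖ (1 : Matrix (Fin (p l)) (Fin (p l)) ℂ)) *
      rowBlock W l = X₀
    have hs := mem_span_tensorPow_unitary (hXm ▸ hsymm l m)
    clear hXm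
    induction hs using Submodule.span_induction with
    | mem X hX =>
      obtain ⟨U, rfl⟩ := hX
      exact hM U v hv
    | zero =>
      rw [map_zero, Matrix.zero_mulVec]
      exact M.zero_mem
    | add X Y _ _ hX hY =>
      rw [map_add, Matrix.add_mulVec]
      exact M.add_mem hX hY
    | smul c X _ hX =>
      rw [map_smul, Matrix.smul_mulVec]
      exact M.smul_mem c hX
  · rw [← not_nonempty_iff, nonempty_equiv_matRep_iff]
    rintro ⟨A, B, -, hBA, hA⟩
    have h : ∀ X, IsPermSymmetric X → A * compress W l X = compress W l' X * A := by
      intro X hX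
      have hs := mem_span_tensorPow_unitary hX
      clear hX
      induction hs using Submodule.span_induction with
      | mem X hX =>
        obtain ⟨U, rfl⟩ := hX
        exact hA U
      | zero => rw [map_zero, map_zero, Matrix.mul_zero, Matrix.zero_mul]
      | add X Y _ _ hX hY => rw [map_add, map_add, Matrix.mul_add, Matrix.add_mul, hX, hY]
      | smul c X _ hX => rw [map_smul, map_smul, Matrix.mul_smul, Matrix.smul_mul, hX]
    -- The projection onto block `l` compresses to 1 on `Q_l` and to 0 on `Q_{l'}`, so `A = 0`,
    -- contradicting `B A = 1`.
    replace h := h _ (hsymm l 1)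
    rw [compress_rowBlock_conj hW (hp l), compress_rowBlock_conj_of_ne hW hl.symm (hp l'),
      Matrix.mul_one, Matrix.zero_mul] at h
    rw [h, Matrix.mul_zero] at hBA
    have h1 := congrFun (congrFun hBA ⟨0, hq l⟩) ⟨0, hq l⟩
    simp at h1
  · ext ⟨l, x⟩ ⟨l', y⟩
    rw [← rowBlock_mul_mul_conjTranspose_apply]
    by_cases hl : l = l'
    · subst hl
      rw [rowBlock_conj_self hW' hf hWf (isPermSymmetric_tensorPow _),
        Matrix.blockDiagonal'_apply_eq, hg]
    · rw [rowBlock_conj_of_ne hW' hf hfne hWf (isPermSymmetric_tensorPow _) hl,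
        Matrix.blockDiagonal'_apply_ne _ _ _ hl, Matrix.zero_apply]

/-- There is a pair of dual Schur transforms. -/
theorem exists_isDual : ∃ (k : ℕ) (q p : Fin k → ℕ) (S T : SchurTransform d n (Fin k) q p),
    S.IsDual T := by
  obtain ⟨k, q, p, W, f, hW, hW', hq, hf, hfne, hWf⟩ :=
    exists_isotypic_decomposition (u := permHom d n) permMatrix_conjTranspose
  obtain ⟨S, hS⟩ := exists_schurTransform hW' hf hfne hWf hW hq
  have hct : (W.map (starRingEnd ℂ))ᴴ = Wᴴ.map (starRingEnd ℂ) := rfl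
  -- Since `P_π` is real, the entrywise conjugate of `W` decomposes the same representation, with
  -- conjugated matrices; this is the dual transform.
  obtain ⟨T, hT⟩ := exists_schurTransform (W := W.map (starRingEnd ℂ)) (f := fun l => conjRep (f l))
    (by rw [hct, ← Matrix.map_mul, hW', Matrix.map_one _ (map_zero _) (map_one _)])
    (fun l => isIrreducible_conjRep (hf l))
    (fun l l' hl => isEmpty_equiv_conjRep (hfne l l' hl))
    (fun π => by
      have hπ : (permMatrix π : Matrix (Fin n → d) (Fin n → d) ℂ) =
          (permMatrix π).map (starRingEnd ℂ) := (permMatrix_map_star π).symm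
      have h := hWf π
      change W * (permMatrix π : Matrix (Fin n → d) (Fin n → d) ℂ) * Wᴴ = _ at h
      rw [hct, hπ, ← Matrix.map_mul, ← Matrix.map_mul, h,
        Matrix.blockDiagonal'_map _ _ (map_zero _)]
      congr 1
      ext l x y
      simp [Matrix.kroneckerMap_apply, Matrix.one_apply, conjRep_apply,
        apply_ite (starRingEnd ℂ)])
    (by rw [hct, ← Matrix.map_mul, hW, Matrix.map_one _ (map_zero _) (map_one _)]) hq
  refine ⟨k, q, p, S, T, fun l π => ?_⟩
  rw [hS, hT, conjRep_apply]

end Construction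

end RandomPurification

theorem mainTheorem1 {d : Type*} [Fintype d] [DecidableEq d] (n : ℕ) (hn : 1 ≤ n) :
    -- `R_n` is positive semidefinite, and `Λ^{(n)}` is a channel
    (RandomPurification.R d n).PosSemidef ∧
    RandomPurification.IsChannel (RandomPurification.purify d n) ∧
    -- it is equal to the channel of Tang, Wright and Zhandry, for every choice of dual Schur
    -- transforms on the two systems, and there is such a choice
    (∀ (L : Type) [Fintype L] [DecidableEq L] (q p : L → ℕ)
      (S T : RandomPurification.SchurTransform d n L q p), S.IsDual T →
      ∀ X, RandomPurification.purify d n X = RandomPurification.schurPurify S T X) ∧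
    (∃ (k : ℕ) (q p : Fin k → ℕ) (S T : RandomPurification.SchurTransform d n (Fin k) q p),
      S.IsDual T) ∧
    -- property of random purification, for i.i.d. inputs
    RandomPurification.PurifiesIID n (RandomPurification.purify d n) ∧
    -- together with invariance under permutations of the input it determines `Λ^{(n)}`
    (∀ (π : Equiv.Perm (Fin n)) (X : Matrix (Fin n → d) (Fin n → d) ℂ),
      RandomPurification.purify d n
        (RandomPurification.permMatrix π * X * (RandomPurification.permMatrix π).conjTranspose) =
      RandomPurification.purify d n X) ∧
    (∀ Φ : Matrix (Fin n → d) (Fin n → d) ℂ →ₗ[ℂ]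
        Matrix ((Fin n → d) × (Fin n → d)) ((Fin n → d) × (Fin n → d)) ℂ,
      RandomPurification.PurifiesIID n Φ →
      (∀ (π : Equiv.Perm (Fin n)) (X : Matrix (Fin n → d) (Fin n → d) ℂ),
        Φ (RandomPurification.permMatrix π * X *
          (RandomPurification.permMatrix π).conjTranspose) = Φ X) →
      Φ = RandomPurification.purify d n) ∧
    -- permutationally symmetric inputs
    (∀ ρ : Matrix (Fin n → d) (Fin n → d) ℂ, RandomPurification.IsState ρ →
      RandomPurification.IsPermSymmetric ρ →
      (∃ ψ, RandomPurification.IsSymmPurification ψ ρ) ∧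
      ∀ ψ : (Fin n → d) × (Fin n → d) → ℂ, RandomPurification.IsSymmPurification ψ ρ →
        (∀ U : Matrix.unitaryGroup d ℂ, RandomPurification.IsSymmPurification
          (((1 : Matrix (Fin n → d) (Fin n → d) ℂ) ⊗ₖ
            RandomPurification.tensorPow n (U : Matrix d d ℂ)) *ᵥ ψ) ρ) ∧
        RandomPurification.purify d n ρ =
          RandomPurification.haarMean fun U : Matrix.unitaryGroup d ℂ =>
            ((1 : Matrix (Fin n → d) (Fin n → d) ℂ) ⊗ₖ
                RandomPurification.tensorPow n (U : Matrix d d ℂ)) *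
              RandomPurification.ketbra ψ *
              ((1 : Matrix (Fin n → d) (Fin n → d) ℂ) ⊗ₖ
                RandomPurification.tensorPow n (U : Matrix d d ℂ)).conjTranspose) := by
  refine ⟨RandomPurification.R_posSemidef, RandomPurification.isChannel_purify, ?_,
    RandomPurification.exists_isDual, RandomPurification.purifiesIID_purify,
    RandomPurification.purify_permMatrix_conj, ?_, ?_⟩
  · intro L _ _ q p S T hST X
    exact hST.purify_eq_schurPurify X
  · intro Φ hΦ hΦp
    exact RandomPurification.eq_of_purifiesIID hn hΦ RandomPurification.purifiesIID_purify hΦp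
      RandomPurification.purify_permMatrix_conj
  · intro ρ hρ hs
    exact ⟨RandomPurification.exists_isSymmPurification hρ.1 hs, fun ψ hψ =>
      ⟨hψ.localUnitary_mulVec, RandomPurification.purify_eq_haarMean hψ⟩⟩
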